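/- Conventions. $B(z,r)$ denotes an open ball. A metric space $Z$ is $D$-doubling if every ball $B(z,r)$, $r>0$, contains at most $D$ points that are pairwise at distance at least $r/2$. A compact metric space $Z$ is $L$-linearly locally contractible ($L\ge 1$) if for all $z\in Z$ and $0<r\le \operatorname{diam}(Z)/L$ there is a continuous map $h\colon[0,1]\times B(z,r)\to B(z,Lr)$ with $h(0,\cdot)$ the inclusion and $h(1,\cdot)$ constant. A finite simplicial complex $\mathcal S$ with $\ell$ vertices is realized in $\mathbb R^\ell$ with the standard basis vectors as its vertices; its intrinsic metric is the infimum of the Euclidean lengths of paths in $\mathcal S$ (so each $k$-simplex is isometric to $\operatorname{conv}(e_1,\dots,e_{k+1})\subset\mathbb R^{k+1}$). Proposition. For all integers $D,n\ge 0$ and all real $L\ge 1$ there is a constant $C$, depending only on $D$, $L$ and $n$, with the following property. Let $(M,d)$ be a compact metric space that is $D$-doubling, $L$-linearly locally contractible, of topological dimension $n$, and with $\operatorname{diam}(M)\ge 1$. Then there are a finite simplicial complex $\mathcal S$ of dimension at most $D$ and continuous maps $f\colon M\to\mathcal S$ and $g\colon\mathcal S\to M$ such that: (1) $f$ is $C$-Lipschitz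 with respect to the intrinsic metric of $\mathcal S$ on each connected component of $M$ (hence on all of $M$ if $M$ is connected), and $f$ is $C$-Lipschitz on all of $M$ with respect to the Euclidean metric on $\mathcal S\subset\mathbb R^\ell$; (2) for every continuous $p\colon\mathcal S\to\mathcal S$ with $p(\sigma)\subset\sigma$ for each simplex $\sigma$ of $\mathcal S$, there is a homotopy $h\colon[0,1]\times M\to M$ from $g\circ p\circ f$ to $\mathrm{id}_M$ with $d(h_t(x),x)\le 1/4$ for all $x\in M$ and $0\le t\le 1$. -/

import Mathlib

open scoped NNReal ENNReal unitInterval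

/-- `Z` is `D`-doubling: every open ball `B(z, r)` contains at most `D` points that are
pairwise at distance at least `r / 2`. -/
def IsDoublingSpace (D : ℕ) (Z : Type*) [MetricSpace Z] : Prop :=
  ∀ (z : Z) (r : ℝ), 0 < r → ∀ s : Finset Z, (s : Set Z) ⊆ Metric.ball z r →
    (s : Set Z).Pairwise (fun x y => r / 2 ≤ dist x y) → s.card ≤ D

/-- The bounded metric space `Z` is `L`-linearly locally contractible: for every radius
`0 < r ≤ diam Z / L`, the open ball `B(z, r)` can be contracted to a point inside `B(z, L r)`. -/
def IsLinearlyLocallyContractible (L : ℝ) (Z : Type*) [MetricSpace Z] : Prop :=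
  ∀ (z : Z) (r : ℝ), 0 < r → r ≤ Metric.diam (Set.univ : Set Z) / L →
    ∃ h : C(I × Metric.ball z r, Metric.ball z (L * r)),
      (∀ x, (h (0, x) : Z) = x) ∧ ∃ c, ∀ x, h (1, x) = c

/-- The complex `K` in `ℝ^ℓ` is standard: its vertices are standard basis vectors, so that a
`k`-dimensional simplex of `K` is isometric to the convex hull of the standard basis of
`ℝ^(k+1)`. Every finite abstract simplicial complex has exactly one such geometric realization
once its vertices are numbered. -/
def Geometry.SimplicialComplex.IsStandard {ℓ : ℕ}
    (K : Geometry.SimplicialComplex ℝ (EuclideanSpace ℝ (Fin ℓ))) : Prop :=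
  K.vertices ⊆ Set.range fun i : Fin ℓ => EuclideanSpace.single i (1 : ℝ)

/-- All simplices of `K` have dimension at most `D`. -/
def Geometry.SimplicialComplex.HasDimLE {E : Type*} [AddCommGroup E] [Module ℝ E]
    (K : Geometry.SimplicialComplex ℝ E) (D : ℕ) : Prop :=
  ∀ s ∈ K.faces, s.card ≤ D + 1

/-- The intrinsic (path) distance of the subset `S` of a metric space: the infimum of the lengths
of the paths in `S` from `x` to `y`. It is `∞` if there is no such path of finite length. -/
noncomputable def pathEDist {E : Type*} [MetricSpace E] {S : Set E} (x y : S) : ℝ≥0∞ :=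
  ⨅ γ : Path x y, eVariationOn (fun t : I => (γ t : E)) Set.univ

/-- A self-map `p` of the underlying space of `K` is simplex-preserving if `p(σ) ⊆ σ` for each
simplex `σ` of `K`. -/
def Geometry.SimplicialComplex.IsSimplexPreserving {E : Type*} [AddCommGroup E] [Module ℝ E]
    (K : Geometry.SimplicialComplex ℝ E) (p : K.space → K.space) : Prop :=
  ∀ s ∈ K.faces, ∀ x : K.space,
    (x : E) ∈ convexHull ℝ (s : Set E) → (p x : E) ∈ convexHull ℝ (s : Set E)

/-!
The complex is the nerve of an `ε`-net of `M`, where `ε` depends only on `D` and `L`, and `f` is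
given by the partition of unity of the net. Doubling bounds the number of net points near a
point; this gives the dimension bound and the Euclidean Lipschitz bound
(`IsFiniteNet.sum_abs_netCoord_sub_le`). Two points closer than `ε / 2` are mapped to one
simplex, in which intrinsic and Euclidean distance agree. For points at a larger distance, the
intrinsic distance in the nerve alone need not be bounded linearly: if `M` is a long
snowflake `([0, R], |x - y| ^ (1/2))`, then about `R` edges have to be crossed between points at
distance `R ^ (1/2)`. Therefore all edges between net points in a common path component are
added to the nerve; then any two points of a component have images at distance at most `6`
(`pathEDist_nerveCoord_le`). These edges do no harm in (2), because a simplex-preserving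
`p` moves `f x` only within the simplex carrying `f x`, which is a simplex of the nerve.

The maps to `M` all come from one map `G`, defined on formal convex combinations of
points of `M` (`IsLinearlyLocallyContractible.exists_filling`). It is constructed
by induction on the number of vertices: a simplex is the cone over its boundary from the barycenter,
so a contraction of a ball containing the image of the boundary extends the map
(`ContractsIn.exists_extension`, `exists_map_of_carrier`). Each step costs a factor `2 L + 1` in
diameter. The map `g` is the restriction of `G` to the complex.

For the homotopy in (2), let `u 0 = p ∘ f`, `u 1 = f`, and let `u 2, u 3, …` be the partitions of
unity of nets at the scales `ε / 2, ε / 3, …`. As `G` is defined on the simplices spanned by all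
small finite subsets of `M` at once, it can be applied to the segment between `u i x` and
`u (i + 1) x`, whose vertices are close to `x`, and at most `2 D` in number at every scale by
doubling. The resulting homotopies from `G ∘ u i` to `G ∘ u (i + 1)` move points by amounts
tending to `0`, so their infinite concatenation ends with the identity
(`exists_homotopy_of_telescope`).
-/

/-! ### Simplices spanned by finite sets, and the cone extension -/

section FinsetSimplex

variable {V : Type*}

/-- The closed simplex spanned by the finite set `A`, in barycentric coordinates: the
probability vectors on `V` that vanish outside `A`. The ambient space is the product `V → ℝ`,
so that simplices with different vertex sets lie in one topological space. -/
def finsetSimplex (A : Finset V) : Set (V → ℝ) :=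
  {w | (∀ v, 0 ≤ w v) ∧ (∀ v ∉ A, w v = 0) ∧ ∑ v ∈ A, w v = 1}

/-- The boundary of the simplex spanned by `A`: some barycentric coordinate vanishes. -/
def finsetSimplexBoundary (A : Finset V) : Set (V → ℝ) :=
  {w | w ∈ finsetSimplex A ∧ ∃ a ∈ A, w a = 0}

theorem isClosed_finsetSimplex (A : Finset V) : IsClosed (finsetSimplex A) := by
  simp only [finsetSimplex, Set.ofPred_and, Set.ofPred_forall]
  refine IsClosed.inter ?_ (IsClosed.inter ?_ ?_)
  · exact isClosed_iInter fun v => isClosed_le continuous_const (continuous_apply v)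
  · exact isClosed_iInter fun v => isClosed_iInter fun _ =>
      isClosed_eq (continuous_apply v) continuous_const
  · exact isClosed_eq (by fun_prop) continuous_const

theorem finsetSimplex_le_one {A : Finset V} {w : V → ℝ} (hw : w ∈ finsetSimplex A) (v : V) :
    w v ≤ 1 := by
  by_cases hv : v ∈ A
  · rw [← hw.2.2]
    exact Finset.single_le_sum (fun i _ => hw.1 i) hv
  · rw [hw.2.1 v hv]; exact zero_le_one

theorem isCompact_finsetSimplex (A : Finset V) : IsCompact (finsetSimplex A) :=
  (isCompact_univ_pi fun _ : V => isCompact_Icc (a := (0 : ℝ)) (b := 1)).of_isClosed_subset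
    (isClosed_finsetSimplex A) fun _ hw v _ => ⟨hw.1 v, finsetSimplex_le_one hw v⟩

theorem finsetSimplex_mono {A B : Finset V} (h : A ⊆ B) : finsetSimplex A ⊆ finsetSimplex B := by
  intro w hw
  refine ⟨hw.1, fun v hv => hw.2.1 v fun h' => hv (h h'), ?_⟩
  rw [← hw.2.2]
  exact (Finset.sum_subset h fun v _ hv => hw.2.1 v hv).symm

theorem mem_finsetSimplex_of_forall_notMem {A B : Finset V} {w : V → ℝ}
    (hw : w ∈ finsetSimplex A) (h : ∀ v ∈ A, v ∉ B → w v = 0) : w ∈ finsetSimplex B := by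
  classical
  have h0 : ∀ v ∉ B, w v = 0 := fun v hv => by
    by_cases hA : v ∈ A
    · exact h v hA hv
    · exact hw.2.1 v hA
  refine ⟨hw.1, h0, ?_⟩
  have h1 : ∑ v ∈ A ∪ B, w v = 1 := (finsetSimplex_mono Finset.subset_union_left hw).2.2
  rw [← h1]
  exact Finset.sum_subset Finset.subset_union_right fun v _ hv => h0 v hv

theorem exists_ne_zero_of_mem_finsetSimplex {A : Finset V} {w : V → ℝ} (hw : w ∈ finsetSimplex A) :
    ∃ a ∈ A, w a ≠ 0 := by
  by_contra! h
  have := hw.2.2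
  rw [Finset.sum_eq_zero h] at this
  exact zero_ne_one this

theorem finsetSimplex_convexCombo {A B C : Finset V} {u w : V → ℝ} (hu : u ∈ finsetSimplex A)
    (hw : w ∈ finsetSimplex B) (hA : A ⊆ C) (hB : B ⊆ C) {s t : ℝ} (hs : 0 ≤ s) (ht : 0 ≤ t)
    (hst : s + t = 1) : s • u + t • w ∈ finsetSimplex C := by
  have hu' := finsetSimplex_mono hA hu
  have hw' := finsetSimplex_mono hB hw
  refine ⟨fun v => ?_, fun v hv => ?_, ?_⟩
  · have := hu'.1 v
    have := hw'.1 v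
    simp only [Pi.add_apply, Pi.smul_apply, smul_eq_mul]
    positivity
  · simp [hu'.2.1 v hv, hw'.2.1 v hv]
  · simp only [Pi.add_apply, Pi.smul_apply, smul_eq_mul, Finset.sum_add_distrib,
      ← Finset.mul_sum, hu'.2.2, hw'.2.2]
    linarith

theorem finsetSimplexBoundary_eq_biUnion [DecidableEq V] (A : Finset V) :
    finsetSimplexBoundary A = ⋃ B ∈ {B | ∃ a ∈ A, B = A.erase a}, finsetSimplex B := by
  ext w
  simp only [Set.mem_iUnion, exists_prop, Set.mem_ofPred_eq]
  constructor
  · rintro ⟨hw, a, ha, h0⟩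
    refine ⟨_, ⟨a, ha, rfl⟩, mem_finsetSimplex_of_forall_notMem hw fun v hv hv' => ?_⟩
    have : v = a := by by_contra h; exact hv' (Finset.mem_erase.2 ⟨h, hv⟩)
    rw [this, h0]
  · rintro ⟨_, ⟨a, ha, rfl⟩, hw⟩
    exact ⟨finsetSimplex_mono (Finset.erase_subset _ _) hw, a, ha, hw.2.1 a (by simp)⟩

theorem isClosed_biUnion_finsetSimplex {T : Set (Finset V)} (hT : T.Finite) :
    IsClosed (⋃ A ∈ T, finsetSimplex A) :=
  hT.isClosed_biUnion fun A _ => isClosed_finsetSimplex A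

theorem continuousOn_biUnion_finsetSimplex {Z : Type*} [TopologicalSpace Z] {T : Set (Finset V)}
    (hT : T.Finite) {G : (V → ℝ) → Z} (h : ∀ A ∈ T, ContinuousOn G (finsetSimplex A)) :
    ContinuousOn G (⋃ A ∈ T, finsetSimplex A) := by
  have : Finite T := hT
  rw [Set.biUnion_eq_iUnion]
  exact (locallyFinite_of_finite _).continuousOn_iUnion (fun A => isClosed_finsetSimplex _)
    fun A => h A A.2

theorem finite_setOf_eq_erase [DecidableEq V] (A : Finset V) :
    {B | ∃ a ∈ A, B = A.erase a}.Finite := by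
  refine (A.image fun a => A.erase a).finite_toSet.subset ?_
  rintro _ ⟨a, ha, rfl⟩
  exact Finset.mem_coe.2 (Finset.mem_image_of_mem _ ha)

theorem isClosed_finsetSimplexBoundary (A : Finset V) : IsClosed (finsetSimplexBoundary A) := by
  classical
  rw [finsetSimplexBoundary_eq_biUnion]
  exact isClosed_biUnion_finsetSimplex (finite_setOf_eq_erase A)

theorem isCompact_finsetSimplexBoundary (A : Finset V) : IsCompact (finsetSimplexBoundary A) :=
  (isCompact_finsetSimplex A).of_isClosed_subset (isClosed_finsetSimplexBoundary A) fun _ h => h.1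

open Classical in
/-- The barycenter of the simplex spanned by `A`. -/
noncomputable def finsetBarycenter (A : Finset V) : V → ℝ :=
  fun v => if v ∈ A then (A.card : ℝ)⁻¹ else 0

theorem finsetBarycenter_mem {A : Finset V} (hA : A.Nonempty) :
    finsetBarycenter A ∈ finsetSimplex A := by
  have : (A.card : ℝ) ≠ 0 := by exact_mod_cast hA.card_pos.ne'
  refine ⟨fun v => ?_, fun v hv => by simp [finsetBarycenter, hv], ?_⟩
  · unfold finsetBarycenter; split_ifs <;> positivity
  · have h : ∑ v ∈ A, finsetBarycenter A v = ∑ v ∈ A, (A.card : ℝ)⁻¹ :=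
      Finset.sum_congr rfl fun v hv => if_pos hv
    rw [h, Finset.sum_const, nsmul_eq_mul, mul_inv_cancel₀ this]

/-- The simplex as a cone over its boundary with apex the barycenter, reached at `s = 1`. -/
noncomputable def boundaryCone (A : Finset V) (s : ℝ) (q : V → ℝ) : V → ℝ :=
  (1 - s) • q + s • finsetBarycenter A

theorem boundaryCone_mem {A : Finset V} {s : ℝ} (hs : s ∈ Set.Icc (0 : ℝ) 1) {q : V → ℝ}
    (hq : q ∈ finsetSimplexBoundary A) : boundaryCone A s q ∈ finsetSimplex A := by
  obtain ⟨hq, a, ha, -⟩ := hq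
  exact finsetSimplex_convexCombo hq (finsetBarycenter_mem ⟨a, ha⟩) subset_rfl subset_rfl
    (by linarith [hs.2]) hs.1 (by ring)

theorem boundaryCone_surj {A : Finset V} (hA : 2 ≤ A.card) {w : V → ℝ}
    (hw : w ∈ finsetSimplex A) :
    ∃ s ∈ Set.Icc (0 : ℝ) 1, ∃ q ∈ finsetSimplexBoundary A, boundaryCone A s q = w := by
  classical
  have hne : A.Nonempty := Finset.card_pos.1 (by lia)
  have hc : (0 : ℝ) < A.card := by exact_mod_cast hne.card_pos
  obtain ⟨a, ha, hmin⟩ := A.exists_min_image w hne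
  have hle : A.card * w a ≤ 1 := by
    rw [← hw.2.2, ← nsmul_eq_mul]
    exact Finset.card_nsmul_le_sum _ _ _ hmin
  have h0 : 0 ≤ A.card * w a := mul_nonneg hc.le (hw.1 a)
  rcases hle.lt_or_eq with hlt | heq
  · have h1 : 0 < 1 - A.card * w a := by linarith
    refine ⟨A.card * w a, ⟨h0, hle⟩,
      fun v => (w v - if v ∈ A then w a else 0) / (1 - A.card * w a),
      ⟨⟨fun v => ?_, fun v hv => ?_, ?_⟩, a, ha, by simp [ha]⟩, ?_⟩
    · by_cases hv : v ∈ A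
      · have := hmin v hv
        simp only [hv, if_true]
        exact div_nonneg (by linarith) h1.le
      · simp [hv, hw.2.1 v hv]
    · simp [hv, hw.2.1 v hv]
    · rw [← Finset.sum_div, Finset.sum_sub_distrib, hw.2.2,
        Finset.sum_congr rfl (fun v hv => if_pos hv), Finset.sum_const, nsmul_eq_mul,
        div_self h1.ne']
    · ext v
      simp only [boundaryCone, finsetBarycenter, Pi.add_apply, Pi.smul_apply, smul_eq_mul]
      by_cases hv : v ∈ A
      · simp only [hv, if_true]
        field_simp
        ring
      · simp [hv, hw.2.1 v hv]
  · obtain ⟨b, hb, hba⟩ := Finset.exists_mem_ne (by lia : 1 < A.card) a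
    refine ⟨1, by simp, Pi.single a 1, ⟨⟨fun v => ?_, fun v hv => ?_, ?_⟩, b, hb, ?_⟩, ?_⟩
    · rw [Pi.single_apply]; split_ifs <;> norm_num
    · exact Pi.single_eq_of_ne (by rintro rfl; exact hv ha) _
    · simp [Pi.single_apply, ha]
    · exact Pi.single_eq_of_ne hba _
    · have hsum : ∑ v ∈ A, (w v - w a) = 0 := by
        rw [Finset.sum_sub_distrib, hw.2.2, Finset.sum_const, nsmul_eq_mul, heq, sub_self]
      have hall := (Finset.sum_eq_zero_iff_of_nonneg fun v hv => sub_nonneg.2 (hmin v hv)).1 hsum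
      have hwa : w a = (A.card : ℝ)⁻¹ := by field_simp; linarith
      ext v
      simp only [boundaryCone, finsetBarycenter, Pi.add_apply, Pi.smul_apply, smul_eq_mul]
      by_cases hv : v ∈ A
      · have := hall v hv
        simp only [hv, if_true]
        linarith
      · simp [hv, hw.2.1 v hv]

theorem le_of_boundaryCone_eq {A : Finset V} {s s' : ℝ} {q q' : V → ℝ}
    (hs' : s' ≤ 1) (hq : q ∈ finsetSimplexBoundary A) (hq' : q' ∈ finsetSimplexBoundary A)
    (h : boundaryCone A s q = boundaryCone A s' q') : s' ≤ s := by
  obtain ⟨-, a, ha, h0⟩ := hq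
  have hc : (0 : ℝ) < (A.card : ℝ)⁻¹ :=
    inv_pos.2 (by exact_mod_cast (Finset.card_pos.2 ⟨a, ha⟩))
  have := congrFun h a
  simp only [boundaryCone, finsetBarycenter, Pi.add_apply, Pi.smul_apply, smul_eq_mul, ha,
    if_true, h0, mul_zero, zero_add] at this
  have h1 : 0 ≤ (1 - s') * q' a := mul_nonneg (by linarith) (hq'.1.1 a)
  nlinarith

theorem boundaryCone_inj {A : Finset V} {s s' : ℝ} {q q' : V → ℝ} (hs : s ≤ 1)
    (hs' : s' ≤ 1) (hq : q ∈ finsetSimplexBoundary A) (hq' : q' ∈ finsetSimplexBoundary A)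
    (h : boundaryCone A s q = boundaryCone A s' q') : s = s' ∧ (s = 1 ∨ q = q') := by
  have hss : s = s' := le_antisymm (le_of_boundaryCone_eq hs hq' hq h.symm)
    (le_of_boundaryCone_eq hs' hq hq' h)
  subst hss
  refine ⟨rfl, or_iff_not_imp_left.2 fun h1 => ?_⟩
  have h2 : 1 - s ≠ 0 := fun h => h1 (by linarith)
  simp only [boundaryCone, add_left_inj] at h
  exact smul_right_injective _ h2 h

end FinsetSimplex

/-- The subset `U` can be contracted to a point within the subset `W`. -/
def ContractsIn {Z : Type*} [TopologicalSpace Z] (U W : Set Z) : Prop :=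
  ∃ h : C(I × U, Z), (∀ x, h (0, x) = x) ∧ (∃ c, ∀ x, h (1, x) = c) ∧ ∀ p, h p ∈ W

/-- A map from the boundary of a simplex into a set `U` that contracts inside `W` extends to a map
from the simplex to `W`: run the contraction along the rays to the barycenter. -/
theorem ContractsIn.exists_extension {V Z : Type*} [TopologicalSpace Z] {U W : Set Z}
    (hUW : ContractsIn U W) {A : Finset V} (hA : 2 ≤ A.card) {φ : (V → ℝ) → Z}
    (hφ : ContinuousOn φ (finsetSimplexBoundary A))
    (hφU : Set.MapsTo φ (finsetSimplexBoundary A) U) :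
    ∃ F : (V → ℝ) → Z, ContinuousOn F (finsetSimplex A) ∧
      Set.EqOn F φ (finsetSimplexBoundary A) ∧ Set.MapsTo F (finsetSimplex A) W := by
  classical
  obtain ⟨h, h0, ⟨c, h1⟩, hW⟩ := hUW
  have : CompactSpace (finsetSimplexBoundary A) :=
    isCompact_iff_compactSpace.1 (isCompact_finsetSimplexBoundary A)
  let π : I × finsetSimplexBoundary A → finsetSimplex A :=
    fun x => ⟨boundaryCone A x.1 x.2, boundaryCone_mem x.1.2 x.2.2⟩
  have hπ : Continuous π := by
    refine Continuous.subtype_mk ?_ _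
    unfold boundaryCone
    fun_prop
  have hsurj : Function.Surjective π := by
    rintro ⟨w, hw⟩
    obtain ⟨s, hs, q, hq, e⟩ := boundaryCone_surj hA hw
    exact ⟨(⟨s, hs⟩, ⟨q, hq⟩), Subtype.ext e⟩
  have hquot : Topology.IsQuotientMap π := hπ.isClosedMap.isQuotientMap hπ hsurj
  let Ψ : I × finsetSimplexBoundary A → Z := fun x => h (x.1, ⟨φ x.2, hφU x.2.2⟩)
  have hΨ : Continuous Ψ := by
    refine h.continuous.comp (continuous_fst.prodMk (Continuous.subtype_mk ?_ _))
    exact (continuousOn_iff_continuous_domRestrict.1 hφ).comp continuous_snd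
  have hfib : ∀ x y, π x = π y → Ψ x = Ψ y := by
    rintro ⟨s, q⟩ ⟨s', q'⟩ e
    obtain ⟨e1, e2⟩ := boundaryCone_inj s.2.2 s'.2.2 q.2 q'.2 (congrArg Subtype.val e)
    have e1' : s = s' := Subtype.ext e1
    subst e1'
    rcases e2 with e2 | e2
    · have : s = 1 := Subtype.ext e2
      subst this
      simp only [Ψ, h1]
    · have : q = q' := Subtype.ext e2
      subst this
      rfl
  let F : finsetSimplex A → Z := fun w => Ψ (Function.surjInv hsurj w)
  have hFπ : ∀ x, F (π x) = Ψ x := fun x => hfib _ _ (Function.surjInv_eq hsurj _)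
  have hF : Continuous F := by
    rw [hquot.continuous_iff]
    exact hΨ.congr fun x => (hFπ x).symm
  refine ⟨fun w => if hw : w ∈ finsetSimplex A then F ⟨w, hw⟩ else c, ?_, ?_, ?_⟩
  · rw [continuousOn_iff_continuous_domRestrict]
    exact hF.congr fun w => by simp
  · intro q hq
    have e : π (0, ⟨q, hq⟩) = ⟨q, hq.1⟩ := Subtype.ext (by simp [π, boundaryCone])
    simp only [hq.1, dite_true]
    rw [← e, hFπ]
    simp only [Ψ, h0]
  · intro w hw
    simp only [hw, dite_true]
    exact hW _

/-- Maps with prescribed carriers. Let each member `A` of a family of finite sets, closed under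
nonempty subsets, be given a set `Φ A`. If the carriers of the proper faces of `A` lie
in a set that contracts inside `Φ A`, then there is a map, defined on all simplices of the family
at once, that is continuous on each of them and sends the simplex of `A` to `Φ A`. The vertices
are treated as simplices too, and the map is built by induction on the number `N` of vertices. -/
theorem exists_map_of_carrier {V Z : Type*} [TopologicalSpace Z] [Nonempty Z]
    {𝒜 : Set (Finset V)} (hdown : ∀ A ∈ 𝒜, ∀ B ⊆ A, B.Nonempty → B ∈ 𝒜)
    {Φ : Finset V → Set Z} (hvert : ∀ a, {a} ∈ 𝒜 → (Φ {a}).Nonempty)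
    (hext : ∀ A ∈ 𝒜, 2 ≤ A.card →
      ∃ U, (∀ B ⊂ A, B.Nonempty → Φ B ⊆ U) ∧ ContractsIn U (Φ A)) (N : ℕ) :
    ∃ G : (V → ℝ) → Z, ∀ A ∈ 𝒜, A.card ≤ N →
      ContinuousOn G (finsetSimplex A) ∧ Set.MapsTo G (finsetSimplex A) (Φ A) := by
  classical
  induction N with
  | zero =>
    refine ⟨fun _ => Classical.arbitrary Z, fun A _ hA => ?_⟩
    have hempty : finsetSimplex A = ∅ := by
      rw [Finset.card_eq_zero.1 (Nat.le_zero.1 hA)]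
      ext w; simp [finsetSimplex]
    simp [hempty, Set.MapsTo]
  | succ N ih =>
    obtain ⟨G, hG⟩ := ih
    have hF : ∀ A, ∃ F : (V → ℝ) → Z, A ∈ 𝒜 → A.card = N + 1 →
        ContinuousOn F (finsetSimplex A) ∧ Set.EqOn F G (finsetSimplexBoundary A) ∧
          Set.MapsTo F (finsetSimplex A) (Φ A) := by
      intro A
      by_cases hA : A ∈ 𝒜 ∧ A.card = N + 1
      swap
      · exact ⟨G, fun h1 h2 => absurd ⟨h1, h2⟩ hA⟩
      obtain ⟨hA, hcard⟩ := hA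
      rcases Nat.eq_zero_or_pos N with rfl | hN
      · obtain ⟨a, rfl⟩ := Finset.card_eq_one.1 hcard
        obtain ⟨z, hz⟩ := hvert a hA
        refine ⟨fun _ => z, fun _ _ => ⟨continuousOn_const, ?_, fun _ _ => hz⟩⟩
        rintro w ⟨hw, b, hb, h0⟩
        have := hw.2.2
        simp_all
      · obtain ⟨U, hU, hcon⟩ := hext A hA (by lia)
        have hface : ∀ a ∈ A, A.erase a ∈ 𝒜 ∧ (A.erase a).card ≤ N ∧ (A.erase a).Nonempty := by
          intro a ha
          have h1 : (A.erase a).card = N := by rw [Finset.card_erase_of_mem ha, hcard]; rfl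
          have h2 : (A.erase a).Nonempty := Finset.card_pos.1 (by lia)
          exact ⟨hdown A hA _ (Finset.erase_subset _ _) h2, h1.le, h2⟩
        obtain ⟨F, hF1, hF2, hF3⟩ := hcon.exists_extension (A := A) (by lia) (φ := G)
          (by
            rw [finsetSimplexBoundary_eq_biUnion]
            refine continuousOn_biUnion_finsetSimplex (finite_setOf_eq_erase A) ?_
            rintro _ ⟨a, ha, rfl⟩
            exact (hG _ (hface a ha).1 (hface a ha).2.1).1)
          (by
            rw [finsetSimplexBoundary_eq_biUnion]
            intro w hw
            simp only [Set.mem_iUnion, exists_prop, Set.mem_ofPred_eq] at hw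
            obtain ⟨_, ⟨a, ha, rfl⟩, hw⟩ := hw
            obtain ⟨h1, h2, h3⟩ := hface a ha
            exact hU _ (Finset.erase_ssubset ha) h3 ((hG _ h1 h2).2 hw))
        exact ⟨F, fun _ _ => ⟨hF1, hF2, hF3⟩⟩
    choose F hF using hF
    -- In the interior of a simplex with `N + 1` vertices, the simplex is recovered as the support.
    let S : (V → ℝ) → Finset V :=
      fun w => if h : (Function.support w).Finite then h.toFinset else ∅
    have hS : ∀ A, ∀ w ∈ finsetSimplex A, S w = A.filter fun v => w v ≠ 0 := by
      intro A w hw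
      have hsub : Function.support w ⊆ A := fun v hv => by
        by_contra h
        exact hv (hw.2.1 v h)
      have hfin : (Function.support w).Finite := A.finite_toSet.subset hsub
      ext v
      simp only [S, hfin, dite_true, Set.Finite.mem_toFinset, Function.mem_support,
        Finset.mem_filter]
      exact ⟨fun h => ⟨hsub h, h⟩, fun h => h.2⟩
    let G' : (V → ℝ) → Z := fun w => if S w ∈ 𝒜 ∧ (S w).card = N + 1 then F (S w) w else G w
    refine ⟨G', fun A hA hcard => ?_⟩
    rcases hcard.lt_or_eq with hlt | heq
    · have hE : Set.EqOn G' G (finsetSimplex A) := by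
        intro w hw
        have : (S w).card ≤ A.card := by rw [hS A w hw]; exact Finset.card_filter_le _ _
        exact if_neg fun h => by lia
      obtain ⟨h1, h2⟩ := hG A hA (by lia)
      exact ⟨h1.congr hE, h2.congr hE.symm⟩
    · obtain ⟨h1, h2, h3⟩ := hF A hA heq
      have hE : Set.EqOn G' (F A) (finsetSimplex A) := by
        intro w hw
        by_cases hb : ∃ a ∈ A, w a = 0
        · rw [h2 ⟨hw, hb⟩]
          obtain ⟨a, ha, h0⟩ := hb
          refine if_neg fun h => ?_
          have : S w ⊂ A := by
            rw [hS A w hw, Finset.filter_ssubset]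
            exact ⟨a, ha, by simp [h0]⟩
          have := Finset.card_lt_card this
          lia
        · have : S w = A := by
            rw [hS A w hw, Finset.filter_eq_self]
            exact fun a ha h => hb ⟨a, ha, h⟩
          simp only [G', this, hA, heq, and_self, if_true]
      exact ⟨h1.congr hE, h3.congr hE.symm⟩

/-! ### Filling small simplices in a linearly locally contractible space -/

theorem IsDoublingSpace.one_le {D : ℕ} {M : Type*} [MetricSpace M] [Nonempty M]
    (hD : IsDoublingSpace D M) : 1 ≤ D := by
  obtain ⟨z⟩ := ‹Nonempty M›
  simpa using hD z 1 one_pos {z} (by simp) (by simp)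

section LinearlyLocallyContractible

variable {M : Type*} [MetricSpace M] {L : ℝ}

theorem IsLinearlyLocallyContractible.contractsIn (hM : IsLinearlyLocallyContractible L M)
    (hL : 1 ≤ L) (hdiam : 1 ≤ Metric.diam (Set.univ : Set M)) (z : M) {r : ℝ} (hr : 0 < r)
    (hrL : L * r ≤ 1) : ContractsIn (Metric.ball z r) (Metric.ball z (L * r)) := by
  obtain ⟨h, h0, c, h1⟩ := hM z r hr (by rw [le_div_iff₀ (by linarith)]; linarith)
  exact ⟨⟨fun p => h p, by fun_prop⟩, h0, ⟨c, fun x => by simp [h1]⟩, fun p => (h p).2⟩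

theorem ContractsIn.mono {Z : Type*} [TopologicalSpace Z] {U W W' : Set Z} (h : ContractsIn U W)
    (hW : W ⊆ W') : ContractsIn U W' := by
  obtain ⟨h, h0, h1, hh⟩ := h
  exact ⟨h, h0, h1, fun p => hW (hh p)⟩

theorem ContractsIn.joined {Z : Type*} [TopologicalSpace Z] {U W : Set Z} (h : ContractsIn U W)
    {x y : Z} (hx : x ∈ U) (hy : y ∈ U) : Joined x y := by
  obtain ⟨h, h0, ⟨c, h1⟩, -⟩ := h
  have key : ∀ u (hu : u ∈ U), Joined u c := fun u hu =>
    ⟨⟨⟨fun t => h (t, ⟨u, hu⟩), by fun_prop⟩, h0 ⟨u, hu⟩, h1 _⟩⟩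
  exact (key x hx).trans (key y hy).symm

theorem IsLinearlyLocallyContractible.joined (hM : IsLinearlyLocallyContractible L M)
    (hL : 1 ≤ L) (hdiam : 1 ≤ Metric.diam (Set.univ : Set M)) {x y : M}
    (hxy : L * dist x y < 1) : Joined x y := by
  have hL0 : 0 < L := by linarith
  refine (hM.contractsIn hL hdiam y (r := 1 / L) (by positivity) ?_).joined ?_ ?_
  · rw [mul_one_div_cancel hL0.ne']
  · rw [Metric.mem_ball, lt_div_iff₀ hL0]; linarith
  · exact Metric.mem_ball_self (by positivity)

/-- Path components are open, hence clopen, so they contain the connected components. -/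
theorem IsLinearlyLocallyContractible.joined_of_mem_connectedComponent
    (hM : IsLinearlyLocallyContractible L M) (hL : 1 ≤ L)
    (hdiam : 1 ≤ Metric.diam (Set.univ : Set M)) {x y : M} (hy : y ∈ connectedComponent x) :
    Joined x y := by
  have hL0 : 0 < L := by linarith
  have hnear : ∀ z z' : M, dist z z' < 1 / L → Joined z' z := fun z z' h => by
    rw [lt_div_iff₀ hL0] at h
    exact (hM.joined hL hdiam (by linarith)).symm
  have hclopen : IsClopen {z : M | Joined x z} := by
    constructor
    · rw [← isOpen_compl_iff, Metric.isOpen_iff]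
      exact fun z hz => ⟨1 / L, by positivity, fun z' hz' h => hz
        (h.trans (hnear z' z hz').symm)⟩
    · rw [Metric.isOpen_iff]
      exact fun z hz => ⟨1 / L, by positivity, fun z' hz' => Joined.trans hz (hnear z' z hz')⟩
  exact hclopen.connectedComponent_subset (Joined.refl x) hy

/-- `A` is so small that a simplex with these vertices can be filled by iterated contractions. The
factor `2 L + 1` is the loss in each step, and there is a step for each new vertex. -/
def IsFillable (L : ℝ) (A : Finset M) : Prop :=
  (2 * L + 1) ^ A.card * Metric.diam (A : Set M) ≤ 1

/-- The region in which a fillable simplex with vertex set `A` is filled. -/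
def fillRegion (L : ℝ) (A : Finset M) : Set M :=
  {y | ∀ a ∈ A, dist y a ≤ (2 * L + 1) ^ A.card * Metric.diam (A : Set M)}

theorem finset_diam_mono {A B : Finset M} (h : B ⊆ A) :
    Metric.diam (B : Set M) ≤ Metric.diam (A : Set M) :=
  Metric.diam_mono (Finset.coe_subset.2 h) A.finite_toSet.isBounded

theorem finset_dist_le_diam {A : Finset M} {a b : M} (ha : a ∈ A) (hb : b ∈ A) :
    dist a b ≤ Metric.diam (A : Set M) :=
  Metric.dist_le_diam_of_mem A.finite_toSet.isBounded ha hb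

theorem IsFillable.subset (hL : 1 ≤ L) {A B : Finset M} (hA : IsFillable L A) (h : B ⊆ A) :
    IsFillable L B := by
  refine le_trans (mul_le_mul ?_ (finset_diam_mono h) Metric.diam_nonneg (by positivity)) hA
  exact pow_le_pow_right₀ (by linarith) (Finset.card_le_card h)

theorem isFillable_of_dist_le (hL : 1 ≤ L) {A : Finset M} {N : ℕ} (hN : A.card ≤ N) {r : ℝ}
    (hr : 0 ≤ r) (h : ∀ a ∈ A, ∀ b ∈ A, dist a b ≤ r) (hrL : (2 * L + 1) ^ N * r ≤ 1) :
    IsFillable L A := by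
  refine le_trans (mul_le_mul ?_ (Metric.diam_le_of_forall_dist_le hr h) Metric.diam_nonneg
    (by positivity)) hrL
  exact pow_le_pow_right₀ (by linarith) hN

theorem isFillable_of_card_le_one {A : Finset M} (hA : A.card ≤ 1) : IsFillable L A := by
  have : Metric.diam (A : Set M) = 0 :=
    Metric.diam_subsingleton (Finset.card_le_one_iff_subsingleton.1 hA)
  simp [IsFillable, this]

theorem fillRegion_singleton (a : M) : fillRegion L {a} = {a} := by
  ext y
  simp [fillRegion]

/-- One step of the filling: the regions of the proper faces of `A` lie in a common ball, which
contracts inside the region of `A`. -/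
theorem IsLinearlyLocallyContractible.contractsIn_fillRegion
    (hM : IsLinearlyLocallyContractible L M) (hL : 1 ≤ L)
    (hdiam : 1 ≤ Metric.diam (Set.univ : Set M)) {A : Finset M} (hA : IsFillable L A)
    (hcard : 2 ≤ A.card) :
    ∃ U, (∀ B ⊂ A, B.Nonempty → fillRegion L B ⊆ U) ∧ ContractsIn U (fillRegion L A) := by
  obtain ⟨a, ha, b, hb, hab⟩ := Finset.one_lt_card.1 (by lia : 1 < A.card)
  have hd : 0 < Metric.diam (A : Set M) := (dist_pos.2 hab).trans_le (finset_dist_le_diam ha hb)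
  obtain ⟨k, hk⟩ : ∃ k, A.card = k + 1 := ⟨A.card - 1, by lia⟩
  have hk1 : 1 < (2 * L + 1) ^ k := one_lt_pow₀ (by linarith) (by lia)
  unfold IsFillable at hA
  rw [hk, pow_succ] at hA
  set d := Metric.diam (A : Set M) with hdd
  set κ := (2 * L + 1) ^ k with hκ
  have hκd : d < κ * d := by nlinarith
  have hκL : 2 * L * (κ * d) ≤ κ * (2 * L + 1) * d - κ * d := by linarith
  refine ⟨Metric.ball a (2 * (κ * d)), fun B hB hne y hy => ?_,
    (hM.contractsIn hL hdiam a (by positivity) (by nlinarith)).mono fun y hy c hc => ?_⟩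
  · obtain ⟨c, hc⟩ := hne
    have h1 := hy c hc
    have h2 : dist c a ≤ d := finset_dist_le_diam (hB.1 hc) ha
    have h3 : (2 * L + 1) ^ B.card * Metric.diam (B : Set M) ≤ κ * d := by
      refine mul_le_mul ?_ (finset_diam_mono hB.1) Metric.diam_nonneg (by positivity)
      refine pow_le_pow_right₀ (by linarith) ?_
      have := Finset.card_lt_card hB
      lia
    rw [Metric.mem_ball]
    linarith [dist_triangle y c a]
  · rw [Metric.mem_ball] at hy
    have h2 : dist a c ≤ d := finset_dist_le_diam ha hc
    rw [hk, pow_succ]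
    linarith [dist_triangle y a c]

/-- Two points joined by a path form a set that contracts to a point. -/
theorem Joined.contractsIn_pair {Z : Type*} [TopologicalSpace Z] [T1Space Z] {a b : Z}
    (h : Joined a b) : ContractsIn ({a, b} : Set Z) Set.univ := by
  classical
  obtain ⟨γ⟩ := h
  refine ⟨⟨fun p => if (p.2 : Z) = a then γ p.1 else p.2, ?_⟩, ?_, ⟨b, ?_⟩, fun _ => trivial⟩
  · have : Finite ({a, b} : Set Z) := Set.toFinite _
    rw [continuous_prod_of_discrete_right]
    rintro ⟨z, hz⟩
    by_cases hza : z = a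
    · simpa [hza] using γ.continuous
    · simpa [hza] using continuous_const
  · rintro ⟨z, rfl | rfl⟩ <;> simp
    exact fun h => h.symm
  · rintro ⟨z, rfl | rfl⟩ <;> simp

/-- A single map on formal convex combinations of points of `M`, with at most `N` points each, that
is continuous on each fillable simplex, and on each edge between points joined by
a path. The image of a fillable simplex stays within a multiple of its diameter from its vertices;
nothing is claimed about the size of the images of long edges. -/
theorem IsLinearlyLocallyContractible.exists_filling (hM : IsLinearlyLocallyContractible L M)
    (hL : 1 ≤ L) (hdiam : 1 ≤ Metric.diam (Set.univ : Set M)) [Nonempty M] (N : ℕ) :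
    ∃ G : (M → ℝ) → M, ∀ A : Finset M, A.Nonempty → A.card ≤ N →
      (IsFillable L A → ContinuousOn G (finsetSimplex A) ∧
        Set.MapsTo G (finsetSimplex A) (fillRegion L A)) ∧
      (A.card ≤ 2 → (∀ a ∈ A, ∀ b ∈ A, Joined a b) → ContinuousOn G (finsetSimplex A)) := by
  classical
  obtain ⟨G, hG⟩ := exists_map_of_carrier (V := M) (Z := M)
    (𝒜 := {A | A.Nonempty ∧ (IsFillable L A ∨ A.card ≤ 2 ∧ ∀ a ∈ A, ∀ b ∈ A, Joined a b)})
    (Φ := fun A => if IsFillable L A then fillRegion L A else Set.univ)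
    (by
      rintro A ⟨-, hA⟩ B hBA hB
      refine ⟨hB, hA.imp (fun h => h.subset hL hBA) fun h => ?_⟩
      exact ⟨(Finset.card_le_card hBA).trans h.1, fun a ha b hb => h.2 a (hBA ha) b (hBA hb)⟩)
    (fun a _ => by
      rw [if_pos (isFillable_of_card_le_one (by simp)), fillRegion_singleton]
      exact Set.singleton_nonempty a)
    (by
      rintro A ⟨-, hA⟩ hcard
      by_cases hf : IsFillable L A
      · obtain ⟨U, hU, hUA⟩ := hM.contractsIn_fillRegion hL hdiam hf hcard
        refine ⟨U, fun B hB hne => ?_, by simpa only [hf, if_true]⟩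
        rw [if_pos (hf.subset hL hB.1)]
        exact hU B hB hne
      · obtain ⟨hc2, hj⟩ := hA.resolve_left hf
        obtain ⟨a, b, -, rfl⟩ := Finset.card_eq_two.1 (le_antisymm hc2 hcard)
        refine ⟨{a, b}, fun B hB hne => ?_, ?_⟩
        · have h1 : B.card = 1 := by
            have := Finset.card_lt_card hB
            have := hne.card_pos
            lia
          rw [if_pos (isFillable_of_card_le_one h1.le)]
          obtain ⟨c, rfl⟩ := Finset.card_eq_one.1 h1
          rw [fillRegion_singleton]
          have := hB.1 (Finset.mem_singleton_self c)
          simpa using this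
        · simp only [hf, if_false]
          exact (hj a (by simp) b (by simp)).contractsIn_pair) N
  refine ⟨G, fun A hne hN => ⟨fun hf => ?_, fun h2 hj => (hG A ⟨hne, Or.inr ⟨h2, hj⟩⟩ hN).1⟩⟩
  simpa only [hf, if_true] using hG A ⟨hne, Or.inl hf⟩ hN

end LinearlyLocallyContractible

/-! ### Nets and their Lipschitz partitions of unity -/

section Net

variable {M : Type*} [MetricSpace M]

/-- The finite set `N` is an `ε`-net: it is `ε`-separated, and the open `ε`-balls
around its points cover the space. -/
structure IsFiniteNet (ε : ℝ) (N : Finset M) : Prop where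
  le_dist : ∀ a ∈ N, ∀ b ∈ N, a ≠ b → ε ≤ dist a b
  exists_dist_lt : ∀ x, ∃ a ∈ N, dist x a < ε

/-- A separated set with the largest possible number of elements is a net. -/
theorem exists_isFiniteNet [CompactSpace M] {ε : ℝ} (hε : 0 < ε) :
    ∃ N : Finset M, IsFiniteNet ε N := by
  classical
  obtain ⟨t, -, htf, ht⟩ := (isCompact_univ (X := M)).finite_cover_balls (half_pos hε)
  let S : Set ℕ := {k | ∃ N : Finset M, (∀ a ∈ N, ∀ b ∈ N, a ≠ b → ε ≤ dist a b) ∧ N.card = k}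
  have hbdd : BddAbove S := by
    refine ⟨htf.toFinset.card, ?_⟩
    rintro _ ⟨N, hN, rfl⟩
    have hc : ∀ a : M, ∃ c ∈ t, dist a c < ε / 2 := fun a => by
      simpa using ht (Set.mem_univ a)
    choose c hct hc using hc
    refine Finset.card_le_card_of_injOn c (fun a _ => by simpa using hct a) fun a ha b hb hab => ?_
    by_contra hne
    have h1 := hN a ha b hb hne
    have h2 := hc a
    have h3 := hc b
    rw [← hab] at h3
    linarith [dist_triangle_right a b (c a)]
  have hne : S.Nonempty := ⟨0, ∅, by simp, rfl⟩
  obtain ⟨N, hN, hcard⟩ := Nat.sSup_mem hne hbdd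
  refine ⟨N, hN, fun x => ?_⟩
  by_contra! hx
  have hxN : x ∉ N := fun h => by
    have := hx x h
    rw [dist_self] at this
    linarith
  have hmem : N.card + 1 ∈ S := by
    refine ⟨insert x N, fun a ha b hb hab => ?_, Finset.card_insert_of_notMem hxN⟩
    rw [Finset.mem_insert] at ha hb
    rcases ha with rfl | ha <;> rcases hb with rfl | hb
    · exact absurd rfl hab
    · exact hx b hb
    · rw [dist_comm]; exact hx a ha
    · exact hN a ha b hb hab
  have := le_csSup hbdd hmem
  lia

open Classical in
/-- The points of `N` at distance less than `r` from `x`. -/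
noncomputable def netNear (N : Finset M) (r : ℝ) (x : M) : Finset M :=
  N.filter fun v => dist v x < r

theorem mem_netNear {N : Finset M} {r : ℝ} {x v : M} :
    v ∈ netNear N r x ↔ v ∈ N ∧ dist v x < r := by
  simp [netNear]

theorem IsFiniteNet.card_netNear_le {D : ℕ} (hD : IsDoublingSpace D M) {ε : ℝ} (hε : 0 < ε)
    {N : Finset M} (hN : IsFiniteNet ε N) (x : M) : (netNear N (2 * ε) x).card ≤ D := by
  refine hD x (2 * ε) (by positivity) _ (fun v hv => ?_) fun a ha b hb hab => ?_
  · exact (mem_netNear.1 (Finset.mem_coe.1 hv)).2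
  · have := hN.le_dist a (mem_netNear.1 ha).1 b (mem_netNear.1 hb).1 hab
    linarith

theorem netNear_mono (N : Finset M) {r r' : ℝ} (h : r ≤ r') (x : M) :
    netNear N r x ⊆ netNear N r' x := fun v hv => by
  rw [mem_netNear] at hv ⊢
  exact ⟨hv.1, hv.2.trans_le h⟩

/-- The tent function of radius `3 ε / 2` around `v`. The radius lies strictly between `ε`, so that
the sum of the tents is bounded below, and `2 ε`, the scale of the simplices of the nerve. -/
noncomputable def netTent (ε : ℝ) (x v : M) : ℝ := max 0 (3 / 2 * ε - dist x v)

/-- The barycentric coordinates of the partition of unity of the net `N` at the point `x`. -/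
noncomputable def netCoord (ε : ℝ) (N : Finset M) (x : M) : M → ℝ :=
  Set.indicator (N : Set M) fun v => netTent ε x v / ∑ a ∈ N, netTent ε x a

theorem netTent_nonneg (ε : ℝ) (x v : M) : 0 ≤ netTent ε x v := le_max_left _ _

theorem abs_netTent_sub_le (ε : ℝ) (x y v : M) :
    |netTent ε x v - netTent ε y v| ≤ dist x y := by
  refine (abs_max_sub_max_le_max _ _ _ _).trans ?_
  simp only [sub_self, abs_zero, sub_sub_sub_cancel_left]
  refine max_le dist_nonneg ?_
  rw [dist_comm x y]
  exact (abs_dist_sub_le y x v)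

theorem netTent_eq_zero {ε : ℝ} {N : Finset M} {x v : M} (hv : v ∈ N)
    (h : v ∉ netNear N (3 / 2 * ε) x) : netTent ε x v = 0 := by
  have : ¬ dist v x < 3 / 2 * ε := fun h' => h (mem_netNear.2 ⟨hv, h'⟩)
  rw [dist_comm] at this
  exact max_eq_left (by linarith)

theorem IsFiniteNet.half_le_sum {ε : ℝ} {N : Finset M} (hN : IsFiniteNet ε N) (x : M) :
    ε / 2 ≤ ∑ a ∈ N, netTent ε x a := by
  obtain ⟨a, ha, hxa⟩ := hN.exists_dist_lt x
  refine le_trans ?_ (Finset.single_le_sum (fun a _ => netTent_nonneg ε x a) ha)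
  exact le_trans (by linarith) (le_max_right _ _)

theorem IsFiniteNet.netCoord_mem {ε : ℝ} (hε : 0 < ε) {N : Finset M} (hN : IsFiniteNet ε N)
    (x : M) : netCoord ε N x ∈ finsetSimplex (netNear N (3 / 2 * ε) x) := by
  have hS := (half_pos hε).trans_le (hN.half_le_sum x)
  have h : netCoord ε N x ∈ finsetSimplex N := by
    refine ⟨fun v => ?_, fun v hv => Set.indicator_of_notMem (by simpa using hv) _, ?_⟩
    · exact Set.indicator_nonneg (fun v _ => div_nonneg (netTent_nonneg _ _ _) hS.le) v
    · have e : ∀ v ∈ N, netCoord ε N x v = netTent ε x v / ∑ a ∈ N, netTent ε x a :=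
        fun v hv => Set.indicator_of_mem (Finset.mem_coe.2 hv) _
      rw [Finset.sum_congr rfl e, ← Finset.sum_div, div_self hS.ne']
  refine mem_finsetSimplex_of_forall_notMem h fun v hv hv' => ?_
  simp [netCoord, hv, netTent_eq_zero hv hv']

theorem IsFiniteNet.continuous_netCoord {ε : ℝ} (hε : 0 < ε) {N : Finset M}
    (hN : IsFiniteNet ε N) : Continuous (netCoord ε N) := by
  refine continuous_pi fun v => ?_
  by_cases hv : v ∈ N
  · have h : (fun x => netCoord ε N x v) = fun x => netTent ε x v / ∑ a ∈ N, netTent ε x a := by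
      ext x; simp [netCoord, hv]
    rw [h]
    unfold netTent
    exact Continuous.div (by fun_prop) (by fun_prop) fun x =>
      ((half_pos hε).trans_le (hN.half_le_sum x)).ne'
  · have h : (fun x => netCoord ε N x v) = fun _ => 0 := by
      ext x; simp [netCoord, hv]
    rw [h]
    exact continuous_const

/-- The partition of unity is Lipschitz for the sum norm, since at most `2 D` coordinates change
between two points. -/
theorem IsFiniteNet.sum_abs_netCoord_sub_le {D : ℕ} (hD : IsDoublingSpace D M) {ε : ℝ}
    (hε : 0 < ε) {N : Finset M} (hN : IsFiniteNet ε N) (x y : M) :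
    ∑ v ∈ N, |netCoord ε N x v - netCoord ε N y v| ≤ 8 * D / ε * dist x y := by
  classical
  set S : M → ℝ := fun x => ∑ a ∈ N, netTent ε x a with hSdef
  have hS : ∀ x, ε / 2 ≤ S x := hN.half_le_sum
  have hSpos : ∀ x, 0 < S x := fun x => (half_pos hε).trans_le (hS x)
  have hφ : ∑ v ∈ N, |netTent ε x v - netTent ε y v| ≤ 2 * D * dist x y := by
    let A := netNear N (3 / 2 * ε) x ∪ netNear N (3 / 2 * ε) y
    have hAN : A ⊆ N := Finset.union_subset (Finset.filter_subset _ _) (Finset.filter_subset _ _)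
    have hcard : (A.card : ℝ) ≤ 2 * D := by
      have h1 : ∀ z, (netNear N (3 / 2 * ε) z).card ≤ D := fun z =>
        (Finset.card_le_card (netNear_mono N (by linarith) z)).trans (hN.card_netNear_le hD hε z)
      have h2 : A.card ≤ 2 * D := by
        have := Finset.card_union_le (netNear N (3 / 2 * ε) x) (netNear N (3 / 2 * ε) y)
        have := h1 x
        have := h1 y
        lia
      exact_mod_cast h2
    rw [← Finset.sum_subset hAN fun v hv hvA => by
      rw [Finset.mem_union, not_or] at hvA
      rw [netTent_eq_zero hv hvA.1, netTent_eq_zero hv hvA.2, sub_self, abs_zero]]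
    refine (Finset.sum_le_card_nsmul A _ _ fun v _ => abs_netTent_sub_le ε x y v).trans ?_
    rw [nsmul_eq_mul]
    exact mul_le_mul_of_nonneg_right hcard dist_nonneg
  have hSxy : |S y - S x| ≤ 2 * D * dist x y := by
    rw [abs_sub_comm, hSdef]
    simp only
    rw [← Finset.sum_sub_distrib]
    exact (Finset.abs_sum_le_sum_abs _ _).trans hφ
  have hterm : ∀ v ∈ N, |netCoord ε N x v - netCoord ε N y v| ≤
      |netTent ε x v - netTent ε y v| / S x + netTent ε y v * (|S y - S x| / (S x * S y)) := by
    intro v hv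
    have e : netCoord ε N x v - netCoord ε N y v =
        (netTent ε x v - netTent ε y v) / S x + netTent ε y v * ((S y - S x) / (S x * S y)) := by
      simp only [netCoord, Set.indicator_of_mem (Finset.mem_coe.2 hv)]
      have h1 := (hSpos x).ne'
      have h2 := (hSpos y).ne'
      change netTent ε x v / S x - netTent ε y v / S y = _
      field_simp
      ring
    rw [e]
    refine (abs_add_le _ _).trans (le_of_eq ?_)
    rw [abs_div, abs_mul, abs_div, abs_of_pos (hSpos x), abs_of_pos (mul_pos (hSpos x) (hSpos y)),
      abs_of_nonneg (netTent_nonneg ε y v)]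
  refine (Finset.sum_le_sum hterm).trans ?_
  rw [Finset.sum_add_distrib, ← Finset.sum_div, ← Finset.sum_mul]
  change _ / S x + S y * (|S y - S x| / (S x * S y)) ≤ _
  have e2 : S y * (|S y - S x| / (S x * S y)) = |S y - S x| / S x := by
    have h1 := (hSpos x).ne'
    have h2 := (hSpos y).ne'
    field_simp
  rw [e2, ← add_div, div_le_iff₀ (hSpos x)]
  have h3 : 8 * D / ε * dist x y * (ε / 2) ≤ 8 * D / ε * dist x y * S x :=
    mul_le_mul_of_nonneg_left (hS x) (by positivity)
  have h4 : 8 * D / ε * dist x y * (ε / 2) = 4 * D * dist x y := by field_simp; ring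
  linarith

end Net

/-! ### The infinite telescope of homotopies -/

section Telescope

/-- The piecewise linear path through the points `u 0, u 1, u 2, …`, with parameter in `[0, ∞)`. -/
noncomputable def polygonalRay {E : Type*} [AddCommGroup E] [Module ℝ E] (u : ℕ → E) (τ : ℝ) : E :=
  (1 - (τ - ⌊τ⌋₊)) • u ⌊τ⌋₊ + (τ - ⌊τ⌋₊) • u (⌊τ⌋₊ + 1)

theorem polygonalRay_eq_sum {E : Type*} [AddCommGroup E] [Module ℝ E] (u : ℕ → E) {τ : ℝ}
    (h0 : 0 ≤ τ) {n : ℕ} (hn : τ < n + 1) :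
    polygonalRay u τ = ∑ i ∈ Finset.range (n + 2), max 0 (1 - |τ - i|) • u i := by
  have hk : ⌊τ⌋₊ ≤ n := by
    rw [← Nat.lt_succ_iff, Nat.floor_lt h0]
    exact_mod_cast hn
  have hfl := Nat.floor_le h0
  have hfl' := Nat.lt_floor_add_one τ
  rw [polygonalRay]
  set k := ⌊τ⌋₊
  rw [Finset.sum_eq_add_of_mem k (k + 1) (by simp; lia) (by simp; lia) (by lia)]
  · congr 2
    · rw [abs_of_nonneg (by linarith), max_eq_right (by linarith)]
    · push_cast
      rw [abs_of_nonpos (by linarith), max_eq_right (by linarith)]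
      ring
  · rintro i - ⟨h1, h2⟩
    rw [max_eq_left, zero_smul]
    rcases lt_or_gt_of_ne h1 with h | h
    · have : (i : ℝ) + 1 ≤ k := by exact_mod_cast h
      have := le_abs_self (τ - i)
      linarith
    · have h' : k + 2 ≤ i := by lia
      have : (k : ℝ) + 2 ≤ i := by exact_mod_cast h'
      have := neg_le_abs (τ - i)
      linarith

variable {M : Type*} [MetricSpace M]

/-- Let `G` be a map on formal convex combinations, and let `u i` be maps from `M` to
formal convex combinations such that `u i x` and `u (i + 1) x` always lie in a simplex on which
`G` is continuous and stays within `δ i` of `x`. If `δ` tends to `0`, then the straight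
homotopies from `G ∘ u i` to `G ∘ u (i + 1)` fit together to a homotopy from `G ∘ u 0` to the
identity. -/
theorem exists_homotopy_of_telescope {G : (M → ℝ) → M} {u : ℕ → M → M → ℝ}
    (hu : ∀ i, Continuous (u i)) {A : ℕ → M → Finset M} {T : ℕ → Finset M}
    (hAT : ∀ i x, A i x ⊆ T i)
    (hG : ∀ i x, ContinuousOn G (finsetSimplex (A i x)))
    (hu₁ : ∀ i x, u i x ∈ finsetSimplex (A i x))
    (hu₂ : ∀ i x, u (i + 1) x ∈ finsetSimplex (A i x))
    {δ : ℕ → ℝ} (hδ : Filter.Tendsto δ Filter.atTop (nhds 0))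
    (hGδ : ∀ i x, ∀ w ∈ finsetSimplex (A i x), dist (G w) x ≤ δ i) {r : ℝ} (hr : ∀ i, δ i ≤ r) :
    ∃ h : C(I × M, M), (∀ x, h (0, x) = G (u 0 x)) ∧ (∀ x, h (1, x) = x) ∧
      ∀ p, dist (h p) p.2 ≤ r := by
  classical
  -- The interval `[0, 1)` is stretched to `[0, ∞)`.
  let τ : I → ℝ := fun t => t / (1 - t)
  have hτ0 : ∀ t, 0 ≤ τ t := fun t => div_nonneg t.2.1 (by linarith [t.2.2])
  let F : I × M → M → ℝ := fun p => polygonalRay (fun i => u i p.2) (τ p.1)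
  have hFmem : ∀ p, F p ∈ finsetSimplex (A ⌊τ p.1⌋₊ p.2) := fun p => by
    have h1 := Nat.floor_le (hτ0 p.1)
    have h2 := Nat.lt_floor_add_one (τ p.1)
    exact finsetSimplex_convexCombo (hu₁ _ _) (hu₂ _ _) subset_rfl subset_rfl (by linarith)
      (by linarith) (by ring)
  let H : I × M → M := fun p => if p.1 = 1 then p.2 else G (F p)
  have hHδ : ∀ p, p.1 ≠ 1 → dist (H p) p.2 ≤ δ ⌊τ p.1⌋₊ := fun p hp => by
    simp only [H, hp, if_false]
    exact hGδ _ _ _ (hFmem p)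
  have hr0 : 0 ≤ r := ge_of_tendsto' hδ.neg (fun i => neg_le_neg (hr i)) |> fun h => by
    simpa using h
  have hHr : ∀ p, dist (H p) p.2 ≤ r := fun p => by
    by_cases hp : p.1 = 1
    · simpa [H, hp] using hr0
    · exact (hHδ p hp).trans (hr _)
  have hH : Continuous H := by
    rw [continuous_iff_continuousAt]
    rintro ⟨t₀, x₀⟩
    by_cases ht₀ : t₀ = 1
    · subst ht₀
      rw [Metric.continuousAt_iff']
      intro e he
      obtain ⟨k, hk⟩ := (hδ.eventually (gt_mem_nhds (half_pos he))).exists_forall_of_atTop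
      have h1 : ∀ᶠ p : I × M in nhds (1, x₀), (k : ℝ) * (1 - p.1) < p.1 := by
        refine (isOpen_lt (by fun_prop) (by fun_prop)).mem_nhds ?_
        simp
      have h2 : ∀ᶠ p : I × M in nhds (1, x₀), dist p.2 x₀ < e / 2 :=
        (continuous_snd.tendsto (1, x₀)).eventually (Metric.ball_mem_nhds x₀ (half_pos he))
      filter_upwards [h1, h2] with p hp1 hp2
      have hH1 : H (1, x₀) = x₀ := if_pos rfl
      rw [hH1]
      have h3 : dist (H p) p.2 < e / 2 := by
        by_cases hp : p.1 = 1
        · simpa [H, hp] using half_pos he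
        · refine (hHδ p hp).trans_lt (hk _ ?_)
          have hlt : (0 : ℝ) < 1 - p.1 :=
            sub_pos.2 (lt_of_le_of_ne p.1.2.2 fun h => hp (Subtype.ext h))
          refine Nat.le_floor ?_
          rw [le_div_iff₀ hlt]
          exact hp1.le
      linarith [dist_triangle (H p) p.2 x₀]
    · have hlt₀ : (0 : ℝ) < 1 - t₀ :=
        sub_pos.2 (lt_of_le_of_ne t₀.2.2 fun h => ht₀ (Subtype.ext h))
      obtain ⟨n, hn⟩ := exists_nat_gt (τ t₀)
      let O : Set (I × M) := {p | (p.1 : ℝ) < (n + 1) * (1 - p.1)}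
      have hO : IsOpen O := isOpen_lt (by fun_prop) (by fun_prop)
      have hOmem : (t₀, x₀) ∈ O := by
        have : (t₀ : ℝ) < n * (1 - t₀) := (div_lt_iff₀ hlt₀).1 hn
        change (t₀ : ℝ) < (n + 1) * (1 - t₀)
        linarith
      have hO1 : ∀ p ∈ O, (0 : ℝ) < 1 - p.1 := fun p hp => by
        have h0 := p.1.2.1
        have hp' : (p.1 : ℝ) < (n + 1) * (1 - p.1) := hp
        exact pos_of_mul_pos_right (h0.trans_lt hp') (by positivity)
      have hOτ : ∀ p ∈ O, τ p.1 < n + 1 := fun p hp => (div_lt_iff₀ (hO1 p hp)).2 hp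
      -- Before the parameter `n + 1`, only finitely many simplices are met.
      let 𝒯 : Set (Finset M) :=
        {B | B ⊆ (Finset.range (n + 1)).biUnion T ∧ ContinuousOn G (finsetSimplex B)}
      have h𝒯 : 𝒯.Finite :=
        ((Finset.range (n + 1)).biUnion T).powerset.finite_toSet.subset
          fun B hB => Finset.mem_coe.2 (Finset.mem_powerset.2 hB.1)
      have hGc : ContinuousOn G (⋃ B ∈ 𝒯, finsetSimplex B) :=
        continuousOn_biUnion_finsetSimplex h𝒯 fun B hB => hB.2
      have hFm : Set.MapsTo F O (⋃ B ∈ 𝒯, finsetSimplex B) := fun p hp => by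
        refine Set.mem_biUnion (x := A ⌊τ p.1⌋₊ p.2) ⟨?_, hG _ _⟩ (hFmem p)
        refine (hAT _ _).trans (Finset.subset_biUnion_of_mem T (Finset.mem_range.2 ?_))
        rw [Nat.floor_lt (hτ0 p.1)]
        exact_mod_cast hOτ p hp
      have hFc : ContinuousOn F O := by
        have hτc : ContinuousOn (fun p : I × M => τ p.1) O :=
          ContinuousOn.div (by fun_prop) (by fun_prop) fun p hp => (hO1 p hp).ne'
        have : ContinuousOn (fun p : I × M =>
            ∑ i ∈ Finset.range (n + 2), max 0 (1 - |τ p.1 - i|) • u i p.2) O := by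
          have hui : ∀ i, Continuous fun p : I × M => u i p.2 := fun i =>
            (hu i).comp continuous_snd
          have htent : ∀ i : ℕ, ContinuousOn (fun p : I × M => max 0 (1 - |τ p.1 - i|)) O :=
            fun i => (by fun_prop : Continuous fun r : ℝ => max 0 (1 - |r - i|)).comp_continuousOn
              hτc
          exact continuousOn_finsetSum _ fun i _ => (htent i).smul (hui i).continuousOn
        exact this.congr fun p hp => polygonalRay_eq_sum _ (hτ0 _) (hOτ p hp)
      have hHO : ContinuousOn H O := (hGc.comp hFc hFm).congr fun p hp => by
        have : p.1 ≠ 1 := fun h => by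
          have := hO1 p hp
          simp [h] at this
        simp [H, this]
      exact hHO.continuousAt (hO.mem_nhds hOmem)
  refine ⟨⟨H, hH⟩, fun x => ?_, fun x => if_pos rfl, hHr⟩
  have h01 : (0 : I) ≠ 1 := zero_ne_one
  simp [H, F, τ, polygonalRay]

end Telescope

/-! ### Path distance -/

section PathEDist

theorem pathEDist_triangle {E : Type*} [MetricSpace E] {S : Set E} (x y z : S) :
    pathEDist x z ≤ pathEDist x y + pathEDist y z := by
  unfold pathEDist
  simp only [ENNReal.iInf_add, ENNReal.add_iInf]
  refine le_iInf fun γ' => le_iInf fun γ => (iInf_le _ (γ.trans γ')).trans ?_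
  let c : I := ⟨1 / 2, by norm_num, by norm_num⟩
  let φ : I → I := fun t => Set.projIcc 0 1 zero_le_one (2 * (t : ℝ))
  let ψ : I → I := fun t => Set.projIcc 0 1 zero_le_one (2 * (t : ℝ) - 1)
  have hφ : Monotone φ := fun s t h => Set.monotone_projIcc _ (by
    have : (s : ℝ) ≤ t := h
    linarith)
  have hψ : Monotone ψ := fun s t h => Set.monotone_projIcc _ (by
    have : (s : ℝ) ≤ t := h
    linarith)
  set F : I → E := fun t => ((γ.trans γ') t : E) with hF
  have h1 : Set.EqOn F ((fun t : I => (γ t : E)) ∘ φ) (Set.Icc 0 c) := fun t ht => by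
    have h2 : (t : ℝ) ≤ 1 / 2 := ht.2
    simp only [hF, Path.trans_apply, h2, dite_true, Function.comp, φ]
    rw [Set.projIcc_of_mem]
  have h2 : Set.EqOn F ((fun t : I => (γ' t : E)) ∘ ψ) (Set.Icc c 1) := fun t ht => by
    have h2 : 1 / 2 ≤ (t : ℝ) := ht.1
    rcases h2.eq_or_lt with h3 | h3
    · have e : ψ t = 0 := Subtype.ext (by simp [ψ, ← h3])
      simp [hF, Path.trans_apply, ← h3, Function.comp, e]
    · simp only [hF, Path.trans_apply, not_le.2 h3, dite_false, Function.comp, ψ]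
      rw [Set.projIcc_of_mem]
  have hsplit := eVariationOn.Icc_add_Icc F (s := Set.univ) (a := 0) (b := c) (c := 1)
    c.2.1 c.2.2 trivial
  simp only [Set.univ_inter] at hsplit
  have huniv : (Set.Icc 0 1 : Set I) = Set.univ := Set.eq_univ_of_forall fun t => ⟨t.2.1, t.2.2⟩
  rw [← huniv, ← hsplit, eVariationOn.congr h1, eVariationOn.congr h2, huniv]
  exact add_le_add
    (eVariationOn.comp_le_of_monotoneOn _ φ (hφ.monotoneOn _) fun _ _ => trivial)
    (eVariationOn.comp_le_of_monotoneOn _ ψ (hψ.monotoneOn _) fun _ _ => trivial)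

theorem pathEDist_le_edist_of_segment_subset {E : Type*} [NormedAddCommGroup E] [NormedSpace ℝ E]
    {S : Set E} {x y : S} (h : segment ℝ (x : E) y ⊆ S) : pathEDist x y ≤ edist x y := by
  have hmem : ∀ t : I, AffineMap.lineMap (x : E) (y : E) (t : ℝ) ∈ S := fun t => by
    refine h ?_
    rw [segment_eq_image_lineMap]
    exact ⟨t, t.2, rfl⟩
  let γ : Path x y :=
    { toFun := fun t => ⟨AffineMap.lineMap (x : E) (y : E) (t : ℝ), hmem t⟩
      continuous_toFun := by
        refine Continuous.subtype_mk ?_ _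
        exact AffineMap.lineMap_continuous.comp continuous_subtype_val
      source' := Subtype.ext (by simp)
      target' := Subtype.ext (by simp) }
  refine (iInf_le _ γ).trans ?_
  have hlip : LipschitzWith (nndist (x : E) y) (AffineMap.lineMap (x : E) (y : E) : ℝ → E) :=
    lipschitzWith_lineMap _ _
  have h1 := (hlip.lipschitzOnWith (s := Set.univ)).comp_eVariationOn_le
    (g := fun t : I => (t : ℝ)) (s := Set.univ) fun _ _ => trivial
  have h2 : eVariationOn (fun t : I => (t : ℝ)) Set.univ ≤ 1 := by
    have hmono : MonotoneOn (fun t : I => (t : ℝ)) Set.univ := fun _ _ _ _ h => h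
    have := hmono.eVariationOn_eq (a := 0) (b := 1) trivial trivial
    have huniv : (Set.Icc 0 1 : Set I) = Set.univ :=
      Set.eq_univ_of_forall fun t => ⟨t.2.1, t.2.2⟩
    exact le_of_eq (by simpa [huniv] using this)
  calc eVariationOn (fun t : I => (γ t : E)) Set.univ
      ≤ (nndist (x : E) y : ℝ≥0∞) * eVariationOn (fun t : I => (t : ℝ)) Set.univ := h1
    _ ≤ (nndist (x : E) y : ℝ≥0∞) * 1 := by gcongr
    _ = edist x y := by rw [mul_one, ← edist_nndist]; rfl

end PathEDist

/-! ### The standard realization of a finite simplicial complex -/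

section StandardComplex

variable {ℓ : ℕ}

/-- The standard basis of `ℝ^ℓ` as an embedding of the index set. -/
noncomputable def basisEmbedding (ℓ : ℕ) : Fin ℓ ↪ EuclideanSpace ℝ (Fin ℓ) where
  toFun i := EuclideanSpace.single i 1
  inj' := fun i j h => by
    by_contra hij
    have := congrArg (fun y : EuclideanSpace ℝ (Fin ℓ) => y i) h
    simp [hij] at this

theorem basisEmbedding_apply (i j : Fin ℓ) :
    basisEmbedding ℓ i j = if j = i then 1 else 0 := by
  change (EuclideanSpace.single i (1 : ℝ) : EuclideanSpace ℝ (Fin ℓ)) j = _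
  simp

theorem sum_smul_basisEmbedding (y : EuclideanSpace ℝ (Fin ℓ)) :
    ∑ i, y i • basisEmbedding ℓ i = y := by
  ext j
  simp [basisEmbedding_apply]

theorem norm_le_sum_abs (y : EuclideanSpace ℝ (Fin ℓ)) : ‖y‖ ≤ ∑ i, |y i| := by
  conv_lhs => rw [← sum_smul_basisEmbedding y]
  refine (norm_sum_le _ _).trans (Finset.sum_le_sum fun i _ => ?_)
  have h : ‖basisEmbedding ℓ i‖ = 1 := by
    change ‖(EuclideanSpace.single i (1 : ℝ) : EuclideanSpace ℝ (Fin ℓ))‖ = 1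
    simp
  rw [norm_smul, h, mul_one, Real.norm_eq_abs]

theorem affineIndependent_basisEmbedding (ℓ : ℕ) :
    AffineIndependent ℝ (basisEmbedding ℓ) := by
  have h : LinearIndependent ℝ (basisEmbedding ℓ) := by
    rw [Fintype.linearIndependent_iff]
    intro c hc i
    have := congrArg (fun y : EuclideanSpace ℝ (Fin ℓ) => y i) hc
    simpa [basisEmbedding_apply] using this
  exact h.affineIndependent

/-- The face spanned by the basis vectors with index in `A`, in coordinates. -/
theorem mem_convexHull_basisEmbedding {A : Finset (Fin ℓ)} {y : EuclideanSpace ℝ (Fin ℓ)} :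
    y ∈ convexHull ℝ ((A.map (basisEmbedding ℓ) : Finset _) : Set (EuclideanSpace ℝ (Fin ℓ))) ↔
      (fun i => y i) ∈ finsetSimplex A := by
  constructor
  · intro hy
    rw [Finset.mem_convexHull'] at hy
    obtain ⟨w, hw0, hw1, hy⟩ := hy
    rw [Finset.sum_map] at hw1 hy
    have hyj : ∀ j, y j = if j ∈ A then w (basisEmbedding ℓ j) else 0 := fun j => by
      rw [← hy]
      simp [basisEmbedding_apply]
    refine ⟨fun j => ?_, fun j hj => by simp [hyj, hj], ?_⟩
    · change 0 ≤ y j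
      rw [hyj]
      split_ifs with hj
      · exact hw0 _ (Finset.mem_map_of_mem _ hj)
      · exact le_rfl
    · rw [← hw1]
      exact Finset.sum_congr rfl fun j hj => by simp [hyj, hj]
  · intro hy
    rw [← sum_smul_basisEmbedding y, ← Finset.sum_subset (Finset.subset_univ A) fun i _ hi => by
      rw [show y i = 0 from hy.2.1 i hi, zero_smul]]
    exact (convex_convexHull ℝ _).sum_mem (fun i _ => hy.1 i) hy.2.2 fun i hi =>
      subset_convexHull ℝ _ (Finset.mem_coe.2 (Finset.mem_map_of_mem _ hi))

theorem dist_le_two_of_mem_finsetSimplex {A B : Finset (Fin ℓ)} {x y : EuclideanSpace ℝ (Fin ℓ)}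
    (hx : (fun i => x i) ∈ finsetSimplex A) (hy : (fun i => y i) ∈ finsetSimplex B) :
    dist x y ≤ 2 := by
  have key : ∀ {C : Finset (Fin ℓ)} {z : EuclideanSpace ℝ (Fin ℓ)},
      (fun i => z i) ∈ finsetSimplex C → ‖z‖ ≤ 1 := fun {C z} hz => by
    refine (norm_le_sum_abs z).trans (le_of_eq ?_)
    rw [← (finsetSimplex_mono (Finset.subset_univ C) hz).2.2]
    exact Finset.sum_congr rfl fun i _ => abs_of_nonneg (hz.1 i)
  rw [dist_eq_norm]
  linarith [norm_sub_le x y, key hx, key hy]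

/-- The realization in `ℝ^ℓ`, with the standard basis vectors as vertices, of an abstract
simplicial complex on `Fin ℓ`. -/
noncomputable def standardComplex (𝒜 : Set (Finset (Fin ℓ))) (hne : ∀ A ∈ 𝒜, A.Nonempty)
    (hdown : ∀ A ∈ 𝒜, ∀ B ⊆ A, B.Nonempty → B ∈ 𝒜) :
    Geometry.SimplicialComplex ℝ (EuclideanSpace ℝ (Fin ℓ)) :=
  open Classical in
  Geometry.SimplicialComplex.ofAffineIndependent
    { faces := (fun A : Finset (Fin ℓ) => A.map (basisEmbedding ℓ)) '' 𝒜
      isRelLowerSet_faces := by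
        rintro _ ⟨A, hA, rfl⟩
        refine ⟨(hne A hA).map, fun t ht htne => ?_⟩
        obtain ⟨B, hBA, rfl⟩ := Finset.subset_map_iff.1 ht
        exact ⟨B, hdown A hA B hBA (Finset.map_nonempty.1 htne), rfl⟩ }
    (by
      refine (affineIndependent_basisEmbedding ℓ).range.mono ?_
      refine Set.iUnion₂_subset ?_
      rintro _ ⟨A, -, rfl⟩
      rw [Finset.coe_map]
      exact Set.image_subset_range _ _)

variable {𝒜 : Set (Finset (Fin ℓ))} {hne : ∀ A ∈ 𝒜, A.Nonempty}
  {hdown : ∀ A ∈ 𝒜, ∀ B ⊆ A, B.Nonempty → B ∈ 𝒜}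

theorem standardComplex_faces :
    (standardComplex 𝒜 hne hdown).faces =
      (fun A : Finset (Fin ℓ) => A.map (basisEmbedding ℓ)) '' 𝒜 := rfl

theorem standardComplex_isStandard : (standardComplex 𝒜 hne hdown).IsStandard := by
  rintro x ⟨A, -, hA⟩
  have : x ∈ A.map (basisEmbedding ℓ) := by
    have h : A.map (basisEmbedding ℓ) = {x} := hA
    rw [h]; simp
  obtain ⟨i, -, rfl⟩ := Finset.mem_map.1 this
  exact ⟨i, rfl⟩

theorem mem_standardComplex_space {y : EuclideanSpace ℝ (Fin ℓ)} :
    y ∈ (standardComplex 𝒜 hne hdown).space ↔ ∃ A ∈ 𝒜, (fun i => y i) ∈ finsetSimplex A := by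
  rw [Geometry.SimplicialComplex.mem_space_iff, standardComplex_faces]
  simp only [Set.exists_mem_image, mem_convexHull_basisEmbedding]

/-- Within one face, the path distance is at most the Euclidean distance. -/
theorem pathEDist_standardComplex_le {A : Finset (Fin ℓ)} (hA : A ∈ 𝒜)
    {x y : (standardComplex 𝒜 hne hdown).space}
    (hx : (fun i => (x : EuclideanSpace ℝ (Fin ℓ)) i) ∈ finsetSimplex A)
    (hy : (fun i => (y : EuclideanSpace ℝ (Fin ℓ)) i) ∈ finsetSimplex A) :
    pathEDist x y ≤ edist x y := by
  refine pathEDist_le_edist_of_segment_subset (((convex_convexHull ℝ _).segment_subset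
    (mem_convexHull_basisEmbedding.2 hx) (mem_convexHull_basisEmbedding.2 hy)).trans ?_)
  exact Geometry.SimplicialComplex.convexHull_subset_space ⟨A, hA, rfl⟩

/-- Pushing barycentric coordinates forward along an injective map of the vertices. -/
noncomputable def pushCoord {V : Type*} (v : Fin ℓ ↪ V) (y : EuclideanSpace ℝ (Fin ℓ)) : V → ℝ :=
  Function.extend v (fun i => y i) 0

theorem continuous_pushCoord {V : Type*} (v : Fin ℓ ↪ V) : Continuous (pushCoord v) := by
  refine continuous_pi fun a => ?_
  by_cases ha : ∃ i, v i = a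
  · obtain ⟨i, rfl⟩ := ha
    simp only [pushCoord, v.injective.extend_apply]
    fun_prop
  · simp only [pushCoord, Function.extend_apply' _ _ _ ha]
    exact continuous_const

theorem pushCoord_mem {V : Type*} (v : Fin ℓ ↪ V) {A : Finset (Fin ℓ)}
    {y : EuclideanSpace ℝ (Fin ℓ)} (hy : (fun i => y i) ∈ finsetSimplex A) :
    pushCoord v y ∈ finsetSimplex (A.map v) := by
  refine ⟨fun a => ?_, fun a ha => ?_, ?_⟩
  · by_cases h : ∃ i, v i = a
    · obtain ⟨i, rfl⟩ := h
      simpa only [pushCoord, v.injective.extend_apply] using hy.1 i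
    · simp [pushCoord, Function.extend_apply' _ _ _ h]
  · by_cases h : ∃ i, v i = a
    · obtain ⟨i, rfl⟩ := h
      simp only [pushCoord, v.injective.extend_apply]
      exact hy.2.1 i fun hi => ha (Finset.mem_map_of_mem _ hi)
    · simp [pushCoord, Function.extend_apply' _ _ _ h]
  · rw [Finset.sum_map]
    simpa only [pushCoord, v.injective.extend_apply] using hy.2.2

theorem comp_mem_finsetSimplex {V : Type*} (v : Fin ℓ ↪ V) {A : Finset (Fin ℓ)} {w : V → ℝ}
    (hw : w ∈ finsetSimplex (A.map v)) : (fun i => w (v i)) ∈ finsetSimplex A := by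
  refine ⟨fun i => hw.1 _, fun i hi => hw.2.1 _ ?_, ?_⟩
  · rwa [Finset.mem_map' v]
  · rw [← hw.2.2, Finset.sum_map]

end StandardComplex

/-! ### The nerve of a net, completed by edges -/

section Nerve

variable {M : Type*} [MetricSpace M]

/-- The faces of the complex: the sets of vertices that fit into a ball of radius `2 ε`, and,
in addition, all edges between vertices that are joined by a path in `M`. The additional edges make
the path distance bounded over each component of `M`; otherwise it might not be controlled by
the metric of `M`, which need not be a length metric even up to a constant. -/
def nerveFaces {ℓ : ℕ} (v : Fin ℓ ↪ M) (ε : ℝ) : Set (Finset (Fin ℓ)) :=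
  {A | A.Nonempty ∧ ((∃ z, ∀ i ∈ A, dist (v i) z < 2 * ε) ∨
    A.card ≤ 2 ∧ ∀ i ∈ A, ∀ j ∈ A, Joined (v i) (v j))}

theorem nerveFaces_down {ℓ : ℕ} (v : Fin ℓ ↪ M) (ε : ℝ) :
    ∀ A ∈ nerveFaces v ε, ∀ B ⊆ A, B.Nonempty → B ∈ nerveFaces v ε := by
  rintro A ⟨-, hA⟩ B hBA hB
  refine ⟨hB, hA.imp ?_ ?_⟩
  · rintro ⟨z, hz⟩
    exact ⟨z, fun i hi => hz i (hBA hi)⟩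
  · rintro ⟨h1, h2⟩
    exact ⟨(Finset.card_le_card hBA).trans h1, fun i hi j hj => h2 i (hBA hi) j (hBA hj)⟩

/-- The nerve of the net with points `v i`, completed by edges. -/
noncomputable def nerveComplex {ℓ : ℕ} (v : Fin ℓ ↪ M) (ε : ℝ) :
    Geometry.SimplicialComplex ℝ (EuclideanSpace ℝ (Fin ℓ)) :=
  standardComplex (nerveFaces v ε) (fun _ hA => hA.1) (nerveFaces_down v ε)

open Classical in
/-- The indices of the net points at distance less than `r` from `x`. -/
noncomputable def nearIndices {ℓ : ℕ} (v : Fin ℓ ↪ M) (r : ℝ) (x : M) : Finset (Fin ℓ) :=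
  Finset.univ.filter fun i => dist (v i) x < r

theorem mem_nearIndices {ℓ : ℕ} {v : Fin ℓ ↪ M} {r : ℝ} {x : M} {i : Fin ℓ} :
    i ∈ nearIndices v r x ↔ dist (v i) x < r := by
  simp [nearIndices]

theorem map_nearIndices {ℓ : ℕ} {v : Fin ℓ ↪ M} {N : Finset M} (hv : Finset.univ.map v = N)
    (r : ℝ) (x : M) : (nearIndices v r x).map v = netNear N r x := by
  ext a
  rw [mem_netNear, ← hv]
  simp only [Finset.mem_map, mem_nearIndices, Finset.mem_univ, true_and]
  constructor
  · rintro ⟨i, hi, rfl⟩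
    exact ⟨⟨i, rfl⟩, hi⟩
  · rintro ⟨⟨i, rfl⟩, hi⟩
    exact ⟨i, hi, rfl⟩

theorem nearIndices_mem_nerveFaces {ℓ : ℕ} {v : Fin ℓ ↪ M} {ε r : ℝ} {x : M} (hr : r ≤ 2 * ε)
    (hne : (nearIndices v r x).Nonempty) : nearIndices v r x ∈ nerveFaces v ε :=
  ⟨hne, Or.inl ⟨x, fun _ hi => (mem_nearIndices.1 hi).trans_le hr⟩⟩

theorem finite_nerveComplex_faces {ℓ : ℕ} (v : Fin ℓ ↪ M) (ε : ℝ) :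
    (nerveComplex v ε).faces.Finite :=
  (Set.toFinite (nerveFaces v ε)).image _

theorem card_le_of_forall_dist_lt {D ℓ : ℕ} (hD : IsDoublingSpace D M) {v : Fin ℓ ↪ M}
    {N : Finset M} (hv : Finset.univ.map v = N) {ε : ℝ} (hε : 0 < ε) (hN : IsFiniteNet ε N)
    {A : Finset (Fin ℓ)} {z : M} (hz : ∀ i ∈ A, dist (v i) z < 2 * ε) : A.card ≤ D := by
  rw [← Finset.card_map v]
  refine (Finset.card_le_card ?_).trans (hN.card_netNear_le hD hε z)
  rw [← map_nearIndices hv, Finset.map_subset_map]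
  exact fun i hi => mem_nearIndices.2 (hz i hi)

theorem hasDimLE_nerveComplex {D ℓ : ℕ} (hD : IsDoublingSpace D M) (hD1 : 1 ≤ D) {v : Fin ℓ ↪ M}
    {N : Finset M} (hv : Finset.univ.map v = N) {ε : ℝ} (hε : 0 < ε) (hN : IsFiniteNet ε N) :
    (nerveComplex v ε).HasDimLE D := by
  rintro _ ⟨A, ⟨-, hA⟩, rfl⟩
  simp only [Finset.card_map]
  rcases hA with ⟨z, hz⟩ | ⟨h2, -⟩
  · exact (card_le_of_forall_dist_lt hD hv hε hN hz).trans (Nat.le_succ D)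
  · lia

/-- The canonical map of `M` to the nerve of a net. -/
noncomputable def nerveCoord {ℓ : ℕ} (v : Fin ℓ ↪ M) (N : Finset M) (ε : ℝ) (x : M) :
    EuclideanSpace ℝ (Fin ℓ) :=
  WithLp.toLp 2 fun i => netCoord ε N x (v i)

variable {ℓ : ℕ} {v : Fin ℓ ↪ M} {N : Finset M} {ε : ℝ}

theorem nerveCoord_mem (hv : Finset.univ.map v = N) (hε : 0 < ε) (hN : IsFiniteNet ε N) (x : M) :
    (fun i => nerveCoord v N ε x i) ∈ finsetSimplex (nearIndices v (3 / 2 * ε) x) :=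
  comp_mem_finsetSimplex v (w := netCoord ε N x)
    (by rw [map_nearIndices hv]; exact hN.netCoord_mem hε x)

theorem nerveCoord_mem_space (hv : Finset.univ.map v = N) (hε : 0 < ε) (hN : IsFiniteNet ε N)
    (x : M) : nerveCoord v N ε x ∈ (nerveComplex v ε).space := by
  have h := nerveCoord_mem hv hε hN x
  obtain ⟨i, hi, -⟩ := exists_ne_zero_of_mem_finsetSimplex h
  exact mem_standardComplex_space.2
    ⟨_, nearIndices_mem_nerveFaces (by linarith) ⟨i, hi⟩, h⟩

theorem dist_nerveCoord_le {D : ℕ} (hD : IsDoublingSpace D M) (hv : Finset.univ.map v = N)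
    (hε : 0 < ε) (hN : IsFiniteNet ε N) (x y : M) :
    dist (nerveCoord v N ε x) (nerveCoord v N ε y) ≤ 8 * D / ε * dist x y := by
  rw [dist_eq_norm]
  refine (norm_le_sum_abs _).trans (le_trans (le_of_eq ?_)
    (hN.sum_abs_netCoord_sub_le hD hε x y))
  rw [← hv, Finset.sum_map]
  rfl

theorem pathEDist_nerveComplex_le {A : Finset (Fin ℓ)} (hA : A ∈ nerveFaces v ε)
    {a b : (nerveComplex v ε).space}
    (ha : (fun i => (a : EuclideanSpace ℝ (Fin ℓ)) i) ∈ finsetSimplex A)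
    (hb : (fun i => (b : EuclideanSpace ℝ (Fin ℓ)) i) ∈ finsetSimplex A) :
    pathEDist a b ≤ ENNReal.ofReal (dist (a : EuclideanSpace ℝ (Fin ℓ)) b) :=
  (pathEDist_standardComplex_le hA ha hb).trans_eq (edist_dist _ _)

/-- Points of the same component are joined in the nerve by a path whose length is at most their
Euclidean distance, if they are close, and at most `6` in general, by way of an additional
edge. -/
theorem pathEDist_nerveCoord_le {D : ℕ} (hD : IsDoublingSpace D M)
    (hv : Finset.univ.map v = N) (hε : 0 < ε) (hN : IsFiniteNet ε N)
    (hjoin : ∀ x y : M, dist x y < 2 * ε → Joined x y) {x y : M} (hxy : Joined x y)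
    {p q : (nerveComplex v ε).space} (hp : (p : EuclideanSpace ℝ (Fin ℓ)) = nerveCoord v N ε x)
    (hq : (q : EuclideanSpace ℝ (Fin ℓ)) = nerveCoord v N ε y) :
    pathEDist p q ≤ ENNReal.ofReal ((8 * D + 12) / ε * dist x y) := by
  have hx := nerveCoord_mem hv hε hN x
  have hy := nerveCoord_mem hv hε hN y
  rw [← hp] at hx
  rw [← hq] at hy
  have hmono : ∀ z, nearIndices v (3 / 2 * ε) z ⊆ nearIndices v (2 * ε) z := fun z i hi => by
    rw [mem_nearIndices] at hi ⊢
    linarith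
  obtain ⟨i, hi, -⟩ := exists_ne_zero_of_mem_finsetSimplex hx
  obtain ⟨j, hj, -⟩ := exists_ne_zero_of_mem_finsetSimplex hy
  have hAx := nearIndices_mem_nerveFaces (ε := ε) (by linarith) ⟨i, hi⟩
  have hAy := nearIndices_mem_nerveFaces (ε := ε) (by linarith) ⟨j, hj⟩
  rcases lt_or_ge (dist x y) (ε / 2) with hlt | hge
  · have hA := nearIndices_mem_nerveFaces (ε := ε) le_rfl ⟨i, hmono x hi⟩
    have hyA : nearIndices v (3 / 2 * ε) y ⊆ nearIndices v (2 * ε) x := fun k hk => by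
      rw [mem_nearIndices] at hk ⊢
      linarith [dist_triangle (v k) y x, dist_comm x y]
    refine (pathEDist_nerveComplex_le hA (finsetSimplex_mono (hmono x) hx)
      (finsetSimplex_mono hyA hy)).trans ?_
    rw [hp, hq]
    refine ENNReal.ofReal_le_ofReal ((dist_nerveCoord_le hD hv hε hN x y).trans ?_)
    gcongr
    linarith
  · have hvert : ∀ k : Fin ℓ, (fun m => basisEmbedding ℓ k m) ∈ finsetSimplex {k} := fun k =>
      mem_convexHull_basisEmbedding.1 (subset_convexHull ℝ _ (by simp))
    have hkA : ∀ k : Fin ℓ, {k} ∈ nerveFaces v ε := fun k =>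
      ⟨Finset.singleton_nonempty k, Or.inl ⟨v k, by simpa using hε⟩⟩
    let e : Fin ℓ → (nerveComplex v ε).space := fun k =>
      ⟨basisEmbedding ℓ k, mem_standardComplex_space.2 ⟨{k}, hkA k, hvert k⟩⟩
    have hij : Joined (v i) (v j) := by
      have h1 := mem_nearIndices.1 hi
      have h2 := mem_nearIndices.1 hj
      exact ((hjoin _ _ (by linarith)).trans hxy).trans (hjoin _ _ (by linarith)).symm
    classical
    have hA : ({i, j} : Finset (Fin ℓ)) ∈ nerveFaces v ε := by
      refine ⟨⟨i, by simp⟩, Or.inr ⟨Finset.card_le_two, ?_⟩⟩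
      simp only [Finset.mem_insert, Finset.mem_singleton]
      rintro a (rfl | rfl) b (rfl | rfl)
      exacts [Joined.refl _, hij, hij.symm, Joined.refl _]
    have hstep : ∀ {A : Finset (Fin ℓ)} (_ : A ∈ nerveFaces v ε) {a b : (nerveComplex v ε).space},
        (fun i => (a : EuclideanSpace ℝ (Fin ℓ)) i) ∈ finsetSimplex A →
        (fun i => (b : EuclideanSpace ℝ (Fin ℓ)) i) ∈ finsetSimplex A →
        pathEDist a b ≤ ENNReal.ofReal 2 := fun {A} hA {a b} ha hb =>
      (pathEDist_nerveComplex_le hA ha hb).trans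
        (ENNReal.ofReal_le_ofReal (dist_le_two_of_mem_finsetSimplex ha hb))
    have h1 : pathEDist p (e i) ≤ ENNReal.ofReal 2 :=
      hstep hAx hx (finsetSimplex_mono (by simpa using hi) (hvert i))
    have h2 : pathEDist (e i) (e j) ≤ ENNReal.ofReal 2 :=
      hstep hA (finsetSimplex_mono (by simp) (hvert i)) (finsetSimplex_mono (by simp) (hvert j))
    have h3 : pathEDist (e j) q ≤ ENNReal.ofReal 2 :=
      hstep hAy (finsetSimplex_mono (by simpa using hj) (hvert j)) hy
    calc pathEDist p q ≤ pathEDist p (e i) + pathEDist (e i) q := pathEDist_triangle _ _ _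
      _ ≤ pathEDist p (e i) + (pathEDist (e i) (e j) + pathEDist (e j) q) := by
          gcongr; exact pathEDist_triangle _ _ _
      _ ≤ ENNReal.ofReal 2 + (ENNReal.ofReal 2 + ENNReal.ofReal 2) := by gcongr
      _ = ENNReal.ofReal 6 := by
          rw [← ENNReal.ofReal_add (by norm_num) (by norm_num),
            ← ENNReal.ofReal_add (by norm_num) (by norm_num)]
          norm_num
      _ ≤ ENNReal.ofReal ((8 * D + 12) / ε * dist x y) := by
          refine ENNReal.ofReal_le_ofReal ?_
          have h4 : 12 / ε * (ε / 2) ≤ (8 * D + 12) / ε * dist x y := by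
            gcongr
            have : (0 : ℝ) ≤ D := Nat.cast_nonneg D
            linarith
          have h5 : 12 / ε * (ε / 2) = 6 := by field_simp; norm_num
          linarith

end Nerve

theorem IsLinearlyLocallyContractible.exists_filling_near {M : Type*} [MetricSpace M] {L : ℝ}
    (hL : 1 ≤ L) {n : ℕ} {G : (M → ℝ) → M}
    (hG : ∀ A : Finset M, A.Nonempty → A.card ≤ n → IsFillable L A →
      ContinuousOn G (finsetSimplex A) ∧ Set.MapsTo G (finsetSimplex A) (fillRegion L A))
    {A : Finset M} (hA : A.Nonempty) (hn : A.card ≤ n) {x : M} {ρ : ℝ}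
    (h : ∀ a ∈ A, dist a x ≤ ρ) (hρ : (2 * L + 1) ^ n * (2 * ρ) ≤ 1) :
    ContinuousOn G (finsetSimplex A) ∧
      ∀ w ∈ finsetSimplex A, dist (G w) x ≤ (2 * L + 1) ^ n * (3 * ρ) := by
  have hρ0 : 0 ≤ ρ := by
    obtain ⟨a, ha⟩ := hA
    exact dist_nonneg.trans (h a ha)
  have hd : ∀ a ∈ A, ∀ b ∈ A, dist a b ≤ 2 * ρ := fun a ha b hb => by
    linarith [dist_triangle_right a b x, h a ha, h b hb]
  obtain ⟨h1, h2⟩ := hG A hA hn (isFillable_of_dist_le hL hn (by linarith) hd hρ)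
  refine ⟨h1, fun w hw => ?_⟩
  obtain ⟨a, ha⟩ := hA
  have h3 : dist (G w) a ≤ (2 * L + 1) ^ n * (2 * ρ) := by
    refine (h2 hw a ha).trans (mul_le_mul (pow_le_pow_right₀ (by linarith) hn)
      (Metric.diam_le_of_forall_dist_le (by linarith) hd) Metric.diam_nonneg (by positivity))
  have h4 : 1 ≤ (2 * L + 1) ^ n := one_le_pow₀ (by linarith)
  have h5 := h a ha
  nlinarith [dist_triangle (G w) a x]

/-- `f` is required to be `C`-Lipschitz for the intrinsic metric of the complex on each connected
component of `M`, and for the Euclidean metric of `ℝ^ℓ` on all of `M`. -/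
theorem proposition4p3 (D n : ℕ) (L : ℝ) (hL : 1 ≤ L) :
    ∃ C : ℝ≥0, ∀ (M : Type*) [MetricSpace M] [CompactSpace M],
      IsDoublingSpace D M → IsLinearlyLocallyContractible L M →
      smallInductiveDimension M = n → 1 ≤ Metric.diam (Set.univ : Set M) →
      ∃ (ℓ : ℕ) (K : Geometry.SimplicialComplex ℝ (EuclideanSpace ℝ (Fin ℓ)))
        (f : C(M, K.space)) (g : C(K.space, M)),
        K.faces.Finite ∧ K.IsStandard ∧ K.HasDimLE D ∧
        (∀ x y : M, y ∈ connectedComponent x → pathEDist (f x) (f y) ≤ C * edist x y) ∧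
        LipschitzWith C f ∧
        ∀ p : C(K.space, K.space), K.IsSimplexPreserving p →
          ∃ h : ContinuousMap.Homotopy ((g.comp p).comp f) (ContinuousMap.id M),
            ∀ (t : I) (x : M), dist (h (t, x)) x ≤ 1 / 4 := by
  -- The loss in all fillings, over simplices with at most `2 D` vertices, and the scale of the net.
  set κ : ℝ := (2 * L + 1) ^ (2 * D) with hκ
  have hκ1 : 1 ≤ κ := one_le_pow₀ (by linarith)
  set ε : ℝ := 1 / (36 * κ) with hεdef
  have hε : 0 < ε := by positivity
  have hκε : κ * ε = 1 / 36 := by rw [hεdef]; field_simp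
  have hC : 0 ≤ (8 * D + 12) / ε := by positivity
  refine ⟨⟨(8 * D + 12) / ε, hC⟩, fun M _ _ hD hM _ hdiam => ?_⟩
  have hMne : Nonempty M := by
    by_contra h
    rw [not_nonempty_iff] at h
    rw [Set.univ_eq_empty_iff.2 h, Metric.diam_empty] at hdiam
    linarith
  have hD1 := hD.one_le
  have hLε : L * (2 * ε) < 1 := by
    have h1 : 2 * L + 1 ≤ κ := le_self_pow₀ (by linarith) (by lia)
    nlinarith
  have hjoin : ∀ x y : M, dist x y < 2 * ε → Joined x y := fun x y h =>
    hM.joined hL hdiam ((mul_le_mul_of_nonneg_left h.le (by linarith)).trans_lt hLε)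
  obtain ⟨G, hG⟩ := hM.exists_filling hL hdiam (2 * D)
  -- Nets at the scales `ε / (i + 1)`; the nerve is that of the net with index `0`.
  let s : ℕ → ℝ := fun i => ε / (i + 1)
  have hs : ∀ i, 0 < s i := fun i => by positivity
  have hs0 : s 0 = ε := by simp [s]
  choose net hnet using fun i => exists_isFiniteNet (M := M) (hs i)
  obtain ⟨N, hNdef⟩ : ∃ N, net 0 = N := ⟨_, rfl⟩
  have hN : IsFiniteNet ε N := by rw [← hs0, ← hNdef]; exact hnet 0
  let v : Fin N.card ↪ M := N.equivFin.symm.toEmbedding.trans (Function.Embedding.subtype _)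
  have hv : Finset.univ.map v = N := by
    rw [← Finset.map_map, Finset.map_univ_equiv]
    exact Finset.attach_map_val
  let K := nerveComplex v ε
  have hfc : Continuous (nerveCoord v N ε) := by
    refine (PiLp.continuous_toLp 2 _).comp (continuous_pi fun i => ?_)
    exact (continuous_apply (v i)).comp (hN.continuous_netCoord hε)
  let f : C(M, K.space) :=
    ⟨fun x => ⟨nerveCoord v N ε x, nerveCoord_mem_space hv hε hN x⟩, hfc.subtype_mk _⟩
  have hGK : ∀ A ∈ nerveFaces v ε, ContinuousOn G (finsetSimplex (A.map v)) := by
    rintro A ⟨hne, hA⟩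
    rcases hA with ⟨z, hz⟩ | ⟨h2, hj⟩
    · have hc := card_le_of_forall_dist_lt hD hv hε hN hz
      refine ((hG (A.map v) hne.map (by rw [Finset.card_map]; lia)).1 ?_).1
      refine isFillable_of_dist_le hL (N := 2 * D) (r := 4 * ε) (by rw [Finset.card_map]; lia)
        (by positivity) ?_ (by linarith)
      simp only [Finset.mem_map]
      rintro _ ⟨i, hi, rfl⟩ _ ⟨j, hj, rfl⟩
      linarith [dist_triangle_right (v i) (v j) z, hz i hi, hz j hj]
    · refine (hG (A.map v) hne.map (by rw [Finset.card_map]; lia)).2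
        (by rwa [Finset.card_map]) ?_
      simp only [Finset.mem_map]
      rintro _ ⟨i, hi, rfl⟩ _ ⟨j, hj', rfl⟩
      exact hj i hi j hj'
  have hgc : Continuous fun y : K.space => G (pushCoord v y) := by
    have h1 : ContinuousOn G (⋃ B ∈ (fun A => A.map v) '' nerveFaces v ε, finsetSimplex B) := by
      refine continuousOn_biUnion_finsetSimplex ((Set.toFinite _).image _) ?_
      rintro _ ⟨A, hA, rfl⟩
      exact hGK A hA
    refine h1.comp_continuous ((continuous_pushCoord v).comp continuous_subtype_val) fun y => ?_
    obtain ⟨A, hA, hy⟩ := mem_standardComplex_space.1 y.2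
    exact Set.mem_biUnion ⟨A, hA, rfl⟩ (pushCoord_mem v hy)
  let g : C(K.space, M) := ⟨fun y => G (pushCoord v y), hgc⟩
  refine ⟨N.card, K, f, g, finite_nerveComplex_faces v ε, standardComplex_isStandard,
    hasDimLE_nerveComplex hD hD1 hv hε hN, fun x y hxy => ?_, ?_, fun p hp => ?_⟩
  · refine (pathEDist_nerveCoord_le hD hv hε hN hjoin
      (hM.joined_of_mem_connectedComponent hL hdiam hxy) (x := x) (y := y) rfl rfl).trans ?_
    rw [ENNReal.ofReal_mul hC, edist_dist, ENNReal.ofReal_eq_coe_nnreal hC]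
    exact le_rfl
  · refine LipschitzWith.of_dist_le_mul fun x y => ?_
    refine (dist_nerveCoord_le hD hv hε hN x y).trans ?_
    change _ ≤ (8 * D + 12) / ε * dist x y
    gcongr
    linarith
  -- The telescope starts with `p ∘ f`, followed by the partitions of unity of the nets.
  · let u : ℕ → M → M → ℝ := fun i => Nat.casesOn i (fun x => pushCoord v (p (f x)))
      fun i => netCoord (s i) (net i)
    let B : ℕ → M → Finset M := fun i => netNear (net i) (3 / 2 * s i)
    have hBcard : ∀ i x, (B i x).card ≤ D := fun i x =>
      (Finset.card_le_card (netNear_mono _ (by linarith [hs i]) x)).trans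
        ((hnet i).card_netNear_le hD (hs i) x)
    have hBne : ∀ i x, (B i x).Nonempty := fun i x => by
      obtain ⟨a, ha, -⟩ := exists_ne_zero_of_mem_finsetSimplex ((hnet i).netCoord_mem (hs i) x)
      exact ⟨a, ha⟩
    classical
    let A : ℕ → M → Finset M := fun i x => B (i - 1) x ∪ B i x
    have hs_anti : ∀ i, s i ≤ s (i - 1) := fun i => by
      have h1 : ((i - 1 : ℕ) : ℝ) ≤ i := by exact_mod_cast Nat.sub_le i 1
      simp only [s]
      gcongr
    have hs_le : ∀ i, s i ≤ ε := fun i =>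
      div_le_self hε.le (by linarith [Nat.cast_nonneg (α := ℝ) i])
    have hAdist : ∀ i x, ∀ a ∈ A i x, dist a x ≤ 3 / 2 * s (i - 1) := fun i x a ha => by
      rcases Finset.mem_union.1 ha with ha | ha
      · exact (mem_netNear.1 ha).2.le
      · linarith [(mem_netNear.1 ha).2, hs_anti i]
    have hfill : ∀ i x, ContinuousOn G (finsetSimplex (A i x)) ∧
        ∀ w ∈ finsetSimplex (A i x), dist (G w) x ≤ κ * (3 * (3 / 2 * s (i - 1))) := fun i x => by
      refine IsLinearlyLocallyContractible.exists_filling_near hL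
        (fun A hA hn => (hG A hA hn).1) ((hBne i x).mono Finset.subset_union_right) ?_
        (hAdist i x) ?_
      · have := Finset.card_union_le (B (i - 1) x) (B i x)
        have := hBcard i x
        have := hBcard (i - 1) x
        lia
      · have := hs_le (i - 1)
        nlinarith
    obtain ⟨h, h0, h1, hh⟩ := exists_homotopy_of_telescope (G := G) (u := u) (A := A)
      (T := fun i => net (i - 1) ∪ net i) (r := 1 / 4)
      (fun i => by
        cases i with
        | zero =>
          exact (continuous_pushCoord v).comp (continuous_subtype_val.comp (p.comp f).continuous)
        | succ i => exact (hnet i).continuous_netCoord (hs i))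
      (fun i x => Finset.union_subset_union (Finset.filter_subset _ _) (Finset.filter_subset _ _))
      (fun i x => (hfill i x).1)
      (fun i x => by
        cases i with
        | zero =>
          have hx := nerveCoord_mem hv hε hN x
          obtain ⟨j, hj, -⟩ := exists_ne_zero_of_mem_finsetSimplex hx
          have hface := nearIndices_mem_nerveFaces (ε := ε) (by linarith) ⟨j, hj⟩
          have h2 := hp _ ⟨_, hface, rfl⟩ (f x) (mem_convexHull_basisEmbedding.2 hx)
          have h3 := pushCoord_mem v (mem_convexHull_basisEmbedding.1 h2)
          have hB0 : netNear N (3 / 2 * ε) x = B 0 x := by simp only [B, hs0, hNdef]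
          rw [map_nearIndices hv, hB0] at h3
          exact finsetSimplex_mono Finset.subset_union_right h3
        | succ i =>
          exact finsetSimplex_mono Finset.subset_union_left ((hnet i).netCoord_mem (hs i) x))
      (fun i x => finsetSimplex_mono Finset.subset_union_right ((hnet i).netCoord_mem (hs i) x))
      (δ := fun i => κ * (3 * (3 / 2 * s (i - 1))))
      (by
        have h2 : Filter.Tendsto s Filter.atTop (nhds 0) := by
          have := (tendsto_one_div_add_atTop_nhds_zero_nat (𝕜 := ℝ)).const_mul ε
          simpa [s, div_eq_mul_inv] using this
        have h3 := h2.comp (Filter.tendsto_sub_atTop_nat 1)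
        simpa using ((h3.const_mul (3 / 2)).const_mul 3).const_mul κ)
      (fun i x => (hfill i x).2)
      (fun i => by
        have := hs_le (i - 1)
        nlinarith)
    exact ⟨⟨h, h0, h1⟩, fun t x => hh (t, x)⟩
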